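/- **Setting.** Let $d\ge 1$ and let $p$ be a multilinear polynomial (degree at most $1$ in each variable) in $n$ real variables, of total degree at most $d$, whose squared coefficients sum to $1$. Let $m_1,\dots,m_d\ge 0$ be even integers and $A$ a real number. A *decomposition of $p$ with constant $A$* consists of integers $n_1,\dots,n_d\ge 0$ and real multilinear polynomials $h_i$ (in $n_i$ variables) and $P_{i,j}$ (in $n$ variables; $1\le i\le d$, $1\le j\le n_i$) such that 1. $p=\sum_{i=1}^d h_i(P_{i,1},\dots,P_{i,n_i})$ and $n_i\le A\,m_1\cdots m_{i-1}$; 2. $h_i$ has degree at most $i$, its squared coefficients sum to at most $A$, and each variable occurs in at most one monomial of $h_i$; 3. each $P_{i,j}$ is homogeneous of positive degree and its squared coefficients sum to $1$; for each monomial occurring in $h_i$, the degrees of the $P_{i,j}$ that are substituted for its variables sum to at most $d$; 4. $\mathbb E\,|P_{i,j}(G)|^q\le (A\sqrt q)^q$ for all integers $0\le q\le d\,m_i$, where $G$ is a vector of $n$ independent standard Gaussians. For $N\ge 0$ and $C>0$ let $B(\xi)=1-|\xi|^2$ for $|\xi|\le 1$ and $B(\xi)=0$ otherwise on $\mathbb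 R^N$, let $\hat B(x)=(2\pi)^{-N/2}\int B(\xi)e^{-i\langle x,\xi\rangle}\,d\xi$, $\rho_2=|\hat B|^2/\|B\|_{L^2}^2$ and $\rho_C(x)=(C/2)^N\rho_2(Cx/2)$. Given a decomposition and $C_1,\dots,C_d>0$, put, on $\mathbb R^{n_1}\times\cdots\times\mathbb R^{n_d}$, $$f(y_1,\dots,y_d)=\operatorname{sgn}\Big(\sum_i h_i(y_i)\Big),\qquad \rho(y_1,\dots,y_d)=\prod_i\rho_{C_i}(y_i),\qquad \tilde f=f*\rho,$$ and $\tilde F(x)=\tilde f(P_1(x),\dots,P_d(x))$ for $x\in\mathbb R^n$, where $P_i=(P_{i,1},\dots,P_{i,n_i})$. A family of random variables is a *$k$-independent family of standard Gaussians* if each member is a standard Gaussian and any at most $k$ members are jointly independent. **Proposition.** There is an absolute constant $c>0$, and for every $d\ge1$ and every $A$ there is a $K=K(d,A)>0$, such that the following holds. Let $p$, $m_1,\dots,m_d$, a decomposition of $p$ with constant $A$, and $C_1,\dots,C_d>0$ be as above, and let $\epsilon>0$. If $$m_i\ \ge\ K\,n_iC_i^2\quad\text{and}\quad m_i\ \ge\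 \log(2^d/\epsilon)\qquad\text{for all } i,$$ and $k\ge d\,m_i$ for all $i$, then for any two $k$-independent families $X=(X_1,\dots,X_n)$ and $Y=(Y_1,\dots,Y_n)$ of standard Gaussians (possibly on different probability spaces), $$\big|\mathbb E[\tilde F(Y)]-\mathbb E[\tilde F(X)]\big|\ \le\ c\,\epsilon .$$ -/

import Mathlib

open MeasureTheory ProbabilityTheory
open scoped FourierTransform

noncomputable section

namespace PTF

/-! ### Multilinear polynomials and limited independence -/

/-- A polynomial is multilinear if it has degree at most one in each of its variables. -/
def IsMultilinear {σ : Type*} (p : MvPolynomial σ ℝ) : Prop :=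
  ∀ j, p.degreeOf j ≤ 1

/-- The sum of the squares of the coefficients. -/
def sumSqCoeff {σ : Type*} (p : MvPolynomial σ ℝ) : ℝ :=
  ∑ s ∈ p.support, p.coeff s ^ 2

/-- The law of `n` independent standard Gaussians. -/
def stdGaussian (n : ℕ) : Measure (Fin n → ℝ) :=
  Measure.pi fun _ => gaussianReal 0 1

/-- A `k`-independent family of standard Gaussians: every member is a standard Gaussian, and any
at most `k` of the members are (jointly) independent. -/
def IsKIndepGaussian {Ω : Type*} [MeasurableSpace Ω] (μ : Measure Ω) (k : ℕ) {n : ℕ}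
    (X : Fin n → Ω → ℝ) : Prop :=
  (∀ j, HasLaw (X j) (gaussianReal 0 1) μ) ∧
    ∀ S : Finset (Fin n), S.card ≤ k → iIndepFun (fun j : S => X j) μ

/-! ### The decomposition of the polynomial -/

/-- A decomposition `p = ∑ᵢ hᵢ(Pᵢ₁, …, Pᵢₙᵢ)` of a polynomial of degree at most `d` into
polynomials with controlled moments. The classes are indexed by `i : Fin d`, so that the class
with number `i + 1` has index `i`; `N i` is the number of polynomials in the class. All
constants that are implied in the bounds are at most `A`. -/
structure Decomposition (d n : ℕ) (A : ℝ) (m : Fin d → ℕ) (p : MvPolynomial (Fin n) ℝ) where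
  /-- the number of polynomials in each class -/
  N : Fin d → ℕ
  /-- the outer polynomials -/
  h : (i : Fin d) → MvPolynomial (Fin (N i)) ℝ
  /-- the inner polynomials -/
  P : (i : Fin d) → Fin (N i) → MvPolynomial (Fin n) ℝ
  N_le : ∀ i, (N i : ℝ) ≤ A * ∏ j ∈ Finset.Iio i, (m j : ℝ)
  h_multilinear : ∀ i, IsMultilinear (h i)
  P_multilinear : ∀ i j, IsMultilinear (P i j)
  P_homogeneous : ∀ i j, ∃ e : ℕ, 0 < e ∧ (P i j).IsHomogeneous e
  h_degree : ∀ i, (h i).totalDegree ≤ (i : ℕ) + 1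
  monomial_degree : ∀ i, ∀ s ∈ (h i).support, ∑ j ∈ s.support, (P i j).totalDegree ≤ d
  h_sumSq : ∀ i, sumSqCoeff (h i) ≤ A
  P_sumSq : ∀ i j, sumSqCoeff (P i j) = 1
  /-- each variable occurs in at most one monomial of `h i` -/
  h_disjoint : ∀ i, ∀ s ∈ (h i).support, ∀ t ∈ (h i).support, ∀ j,
    j ∈ s.support → j ∈ t.support → s = t
  moment : ∀ i j, ∀ q : ℕ, q ≤ d * m i →
    ∫ y, |MvPolynomial.eval y (P i j)| ^ q ∂(stdGaussian n) ≤ (A * √(q : ℝ)) ^ q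
  decomp : p = ∑ i, MvPolynomial.aeval (P i) (h i)

/-! ### The mollifier -/

/-- `B(ξ) = 1 - |ξ|²` on the unit ball of `ℝⁿ` and `0` outside. -/
def bump (n : ℕ) (ξ : EuclideanSpace ℝ (Fin n)) : ℝ :=
  if ‖ξ‖ ≤ 1 then 1 - ‖ξ‖ ^ 2 else 0

/-- The Fourier transform of `B` in the unitary normalization
`(2π)^(-n/2) ∫ B(ξ) exp(-i⟨x, ξ⟩) dξ`. -/
def bumpHat (n : ℕ) (x : EuclideanSpace ℝ (Fin n)) : ℂ :=
  (((√(2 * Real.pi)) ^ n)⁻¹ : ℝ) •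
    (𝓕 (fun ξ : EuclideanSpace ℝ (Fin n) => (bump n ξ : ℂ))) ((2 * Real.pi)⁻¹ • x)

/-- `ρ₂ = |B̂|² / ‖B‖₂²` on `ℝⁿ`. -/
def rhoTwo (n : ℕ) (x : EuclideanSpace ℝ (Fin n)) : ℝ :=
  ‖bumpHat n x‖ ^ 2 / ∫ ξ, bump n ξ ^ 2

/-- `ρ_C(x) = (C/2)ⁿ ρ₂(C x / 2)` on `ℝⁿ`. -/
def rho (n : ℕ) (C : ℝ) (x : EuclideanSpace ℝ (Fin n)) : ℝ :=
  (C / 2) ^ n * rhoTwo n ((C / 2) • x)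

/-- The product mollifier `ρ(x₁, …, x_d) = ∏ᵢ ρ_{Cᵢ}(xᵢ)` on `ℝ^{n₁} × ⋯ × ℝ^{n_d}`. -/
def rhoProd {d : ℕ} (N : Fin d → ℕ) (C : Fin d → ℝ)
    (x : (i : Fin d) → EuclideanSpace ℝ (Fin (N i))) : ℝ :=
  ∏ i, rho (N i) (C i) (x i)

namespace Decomposition

variable {d n : ℕ} {A : ℝ} {m : Fin d → ℕ} {p : MvPolynomial (Fin n) ℝ}

/-- `f(y₁, …, y_d) = sgn(∑ᵢ hᵢ(yᵢ))`. -/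
def f (D : Decomposition d n A m p) (y : (i : Fin d) → EuclideanSpace ℝ (Fin (D.N i))) : ℝ :=
  Real.sign (∑ i, MvPolynomial.eval (fun j => y i j) (D.h i))

/-- `f̃ = f * ρ`. -/
def fTilde (D : Decomposition d n A m p) (C : Fin d → ℝ) :
    ((i : Fin d) → EuclideanSpace ℝ (Fin (D.N i))) → ℝ :=
  convolution D.f (rhoProd D.N C) (ContinuousLinearMap.mul ℝ ℝ) volume

/-- The vector `P(x) = (P₁(x), …, P_d(x))`. -/
def PVec (D : Decomposition d n A m p) (x : Fin n → ℝ) :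
    (i : Fin d) → EuclideanSpace ℝ (Fin (D.N i)) :=
  fun i => WithLp.toLp 2 fun j => MvPolynomial.eval x (D.P i j)

/-- The mollified threshold function `F̃(x) = f̃(P(x))`. -/
def FTilde (D : Decomposition d n A m p) (C : Fin d → ℝ) (x : Fin n → ℝ) : ℝ :=
  D.fTilde C (D.PVec x)

end Decomposition

end PTF

end

/-! The mollifier is a squared Fourier transform, so it can be approximated by functions that are
polynomial in the shift. As a function of z, ρ_C(y - z) is, up to normalization, |𝓕(exp(iφ) B)|² at
a rescaled point. The phase φ(ξ) = -(C/2)⟨ξ, y⟩ is at most C‖y‖/2 in absolute value on the unit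
ball, where B lives. Keeping only the Taylor terms of degree less than l of the exponential leaves a
density polynomial in y of degree at most 2(l - 1). By Plancherel its L¹ error is at most 2s + s²,
where s bounds the Taylor remainder (`exists_polynomial_density`). Since |f| ≤ 1, integrating f
against the product over the blocks approximates f̃(y) by a polynomial up to ∏(1 + sᵢ)² - 1
(`exists_polynomial_approx`). No smoothness of f enters.

Substituting the inner polynomials gives a polynomial Q in x, with an error dominated by constants
plus multiples of even powers of the Pᵢⱼ. Q and these powers have degree at most k, so their
expectations are the same under k-independence as under full independence
(`IsKIndepGaussian.integral_eval`). With l about mᵢ/(2d), the factor 1/l! in the remainder beats the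
moment growth (A√q)^q once mᵢ ≥ K nᵢ Cᵢ², and each block costs at most exp(-mᵢ)/(d 4^d)
(`exists_block_bound`). Both expectations of F̃ are then within ε of 𝔼 Q(G), which gives c = 2. -/

/-! ### Plancherel for the integral Fourier transform -/

open scoped ContDiff in
-- Both sides have the same integral against every smooth compactly supported test function, because
-- 𝓕 can be moved onto the test function in the L² and in the L¹ theory alike. Working with L¹ ∩ L²
-- is necessary since B has a kink on the unit sphere and is not a Schwartz function.
theorem fourier_toLp_two_ae_eq {E : Type*} [NormedAddCommGroup E] [InnerProductSpace ℝ E]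
    [FiniteDimensional ℝ E] [MeasurableSpace E] [BorelSpace E] {g : E → ℂ}
    (h1 : Integrable g) (h2 : MemLp g 2) :
    ((𝓕 (h2.toLp g) : Lp ℂ 2 (volume : Measure E)) : E → ℂ) =ᵐ[volume] 𝓕 g := by
  have hcont : Continuous (𝓕 g) :=
    VectorFourier.fourierIntegral_continuous Real.continuous_fourierChar
      (by exact continuous_inner) h1
  refine ae_eq_of_integral_contDiff_smul_eq
    ((Lp.memLp _).locallyIntegrable one_le_two) hcont.locallyIntegrable fun φ hφ hφc => ?_
  have hsc : HasCompactSupport (fun x => (φ x : ℂ)) :=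
    hφc.comp_left (g := fun t : ℝ => (t : ℂ)) Complex.ofReal_zero
  have hsm : ContDiff ℝ ∞ (fun x => (φ x : ℂ)) := Complex.ofRealCLM.contDiff.comp hφ
  let ψ : SchwartzMap E ℂ := hsc.toSchwartzMap hsm
  have hψ : ∀ x, ψ x = (φ x : ℂ) := fun x => rfl
  have key := congrArg (fun T => T ψ) (Lp.fourier_toTemperedDistribution_eq (h2.toLp g))
  simp only [TemperedDistribution.fourier_apply, Lp.toTemperedDistribution_apply] at key
  have e1 : ∫ x, (𝓕 ψ) x • (h2.toLp g : E → ℂ) x = ∫ x, (𝓕 ψ) x • g x := by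
    refine integral_congr_ae ?_
    filter_upwards [h2.coeFn_toLp] with x hx
    rw [hx]
  have e2 : ∫ x, (𝓕 (ψ : E → ℂ)) x • g x = ∫ x, ψ x • 𝓕 g x := by
    have := VectorFourier.integral_fourierIntegral_smul_eq_flip (L := innerₗ E)
      (μ := volume) (ν := volume) (f := (ψ : E → ℂ)) (g := g)
      Real.continuous_fourierChar (by exact continuous_inner) ψ.integrable h1
    rw [flip_innerₗ] at this
    exact this
  rw [e1, SchwartzMap.fourier_coe, e2] at key
  simpa [hψ] using key.symm

theorem memLp_two_fourier {E : Type*} [NormedAddCommGroup E] [InnerProductSpace ℝ E]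
    [FiniteDimensional ℝ E] [MeasurableSpace E] [BorelSpace E] {g : E → ℂ}
    (h1 : Integrable g) (h2 : MemLp g 2) : MemLp (𝓕 g) 2 :=
  (memLp_congr_ae (fourier_toLp_two_ae_eq h1 h2)).1 (Lp.memLp _)

theorem integral_norm_sq_fourier {E : Type*} [NormedAddCommGroup E] [InnerProductSpace ℝ E]
    [FiniteDimensional ℝ E] [MeasurableSpace E] [BorelSpace E] {g : E → ℂ}
    (h1 : Integrable g) (h2 : MemLp g 2) : ∫ w, ‖𝓕 g w‖ ^ 2 = ∫ x, ‖g x‖ ^ 2 := by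
  have aux : ∀ F : Lp ℂ 2 (volume : Measure E), ‖F‖ ^ 2 = ∫ x, ‖F x‖ ^ 2 := fun F => by
    have := L2.inner_def (𝕜 := ℂ) F F
    rw [inner_self_eq_norm_sq_to_K] at this
    have h3 : ∀ x, inner ℂ (F x) (F x) = ((‖F x‖ ^ 2 : ℝ) : ℂ) := fun x => by
      rw [inner_self_eq_norm_sq_to_K]; simp
    simp only [h3] at this
    exact_mod_cast this.trans (integral_ofReal (𝕜 := ℂ))
  have h := congrArg (· ^ 2) (Lp.norm_fourier_eq (h2.toLp g))
  simp only [aux] at h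
  have hl : ∫ w, ‖𝓕 g w‖ ^ 2 =
      ∫ w, ‖(𝓕 (h2.toLp g) : Lp ℂ 2 (volume : Measure E)) w‖ ^ 2 := by
    refine integral_congr_ae ?_
    filter_upwards [fourier_toLp_two_ae_eq h1 h2] with x hx
    rw [hx]
  have hr : ∫ w, ‖(h2.toLp g) w‖ ^ 2 = ∫ w, ‖g w‖ ^ 2 := by
    refine integral_congr_ae ?_
    filter_upwards [h2.coeFn_toLp] with x hx
    rw [hx]
  rw [hl, h, hr]

/-! ### Taylor remainder of the imaginary exponential -/

/-- Induction on `l`: the derivative of one remainder is the previous remainder times a unit, so the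
mean value inequality integrates the bound. Allowing the unit to be `I` or `-I` reduces to
nonnegative `x`. -/
theorem norm_exp_mul_I_sub_sum_le (l : ℕ) (x : ℝ) :
    ‖Complex.exp (x * Complex.I) - ∑ a ∈ Finset.range l, (x * Complex.I) ^ a / a.factorial‖
      ≤ |x| ^ l / l.factorial := by
  have main : ∀ (c : ℂ), c.re = 0 → ‖c‖ = 1 → ∀ l : ℕ, ∀ x : ℝ, 0 ≤ x →
      ‖Complex.exp (x * c) - ∑ a ∈ Finset.range l, (x * c) ^ a / a.factorial‖
        ≤ x ^ l / l.factorial := by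
    intro c hc hc1 l
    induction l with
    | zero =>
      intro x hx
      simp [Complex.norm_exp, hc]
    | succ l ih =>
      intro x hx
      have hd : ∀ t : ℝ, HasDerivAt (fun t : ℝ => Complex.exp (t * c) -
          ∑ a ∈ Finset.range (l + 1), (t * c) ^ a / a.factorial)
          (c * (Complex.exp (t * c) - ∑ a ∈ Finset.range l, (t * c) ^ a / a.factorial)) t := by
        intro t
        have h0 : HasDerivAt (fun t : ℝ => (t : ℂ) * c) c t := by
          simpa using (Complex.ofRealCLM.hasDerivAt (x := t)).mul_const c
        have h1 := h0.cexp
        have h2 : HasDerivAt (fun t : ℝ => ∑ a ∈ Finset.range (l + 1), ((t : ℂ) * c) ^ a / a.factorial)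
            (∑ a ∈ Finset.range (l + 1), (a * ((t : ℂ) * c) ^ (a - 1) * c) / a.factorial) t := by
          refine HasDerivAt.fun_sum fun a _ => ?_
          exact (h0.pow a).div_const _
        refine (h1.sub h2).congr_deriv ?_
        rw [Finset.sum_range_succ', mul_sub, Finset.mul_sum, mul_comm c]
        congr 1
        simp only [Nat.cast_zero, zero_mul, zero_div, add_zero]
        refine Finset.sum_congr rfl fun a _ => ?_
        rw [Nat.add_sub_cancel, Nat.factorial_succ]
        push_cast
        have : (a.factorial : ℂ) ≠ 0 := by exact_mod_cast a.factorial_ne_zero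
        have : (a : ℂ) + 1 ≠ 0 := by exact_mod_cast a.succ_ne_zero
        field_simp
      have hB : ∀ t : ℝ, HasDerivAt (fun t : ℝ => t ^ (l + 1) / (l + 1).factorial)
          (t ^ l / l.factorial) t := by
        intro t
        refine ((hasDerivAt_pow (l + 1) t).div_const ((l + 1).factorial : ℝ)).congr_deriv ?_
        rw [Nat.factorial_succ, Nat.add_sub_cancel]
        push_cast
        have : (l.factorial : ℝ) ≠ 0 := by exact_mod_cast l.factorial_ne_zero
        field_simp
      refine image_norm_le_of_norm_deriv_right_le_deriv_boundary (a := 0) (b := x)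
        (fun t _ => (hd t).continuousAt.continuousWithinAt)
        (fun t _ => (hd t).hasDerivWithinAt) ?_ hB ?_ ⟨hx, le_rfl⟩
      · simp [Finset.sum_range_succ']
      · intro t ht
        rw [norm_mul, hc1, one_mul]
        exact ih t ht.1
  rcases le_total 0 x with hx | hx
  · simpa [abs_of_nonneg hx] using main Complex.I (by simp) (by simp) l x hx
  · simpa [abs_of_nonpos hx] using main (-Complex.I) (by simp) (by simp) l (-x) (by linarith)

/-! ### The mollifier as the squared Fourier transform of a modulated bump -/

namespace PTF

theorem bump_eq_max (N : ℕ) : bump N = fun ξ => max (1 - ‖ξ‖ ^ 2) 0 := by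
  funext ξ
  unfold bump
  split_ifs with h
  · rw [max_eq_left]; nlinarith [norm_nonneg ξ]
  · rw [max_eq_right]; nlinarith [norm_nonneg ξ]

theorem continuous_bump (N : ℕ) : Continuous (bump N) := by
  rw [bump_eq_max]; fun_prop

theorem bump_eq_zero {N : ℕ} {ξ : EuclideanSpace ℝ (Fin N)} (h : 1 < ‖ξ‖) : bump N ξ = 0 :=
  if_neg (not_le.2 h)

theorem hasCompactSupport_bump (N : ℕ) : HasCompactSupport (bump N) :=
  HasCompactSupport.intro (isCompact_closedBall 0 1) fun ξ hξ => bump_eq_zero (by simpa using hξ)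

theorem hasCompactSupport_bump_sq (N : ℕ) : HasCompactSupport fun ξ => bump N ξ ^ 2 :=
  (hasCompactSupport_bump N).comp_left (g := fun t : ℝ => t ^ 2) (by simp)

theorem integrable_bump_sq (N : ℕ) : Integrable fun ξ => bump N ξ ^ 2 := by
  have h : Continuous fun ξ => bump N ξ ^ 2 := (continuous_bump N).pow 2
  exact h.integrable_of_hasCompactSupport (hasCompactSupport_bump_sq N)

theorem integral_bump_sq_pos (N : ℕ) : 0 < ∫ ξ, bump N ξ ^ 2 := by
  refine Continuous.integral_pos_of_hasCompactSupport_nonneg_nonzero (x := 0)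
    ((continuous_bump N).pow 2) (hasCompactSupport_bump_sq N)
    (fun _ => sq_nonneg _) ?_
  simp [bump]

section window

variable {N : ℕ}

theorem continuous_mul_bump {g : EuclideanSpace ℝ (Fin N) → ℂ} (hg : Continuous g) :
    Continuous fun ξ => g ξ * (bump N ξ : ℂ) :=
  hg.mul (Complex.continuous_ofReal.comp (continuous_bump N))

theorem hasCompactSupport_mul_bump (g : EuclideanSpace ℝ (Fin N) → ℂ) :
    HasCompactSupport fun ξ => g ξ * (bump N ξ : ℂ) :=
  ((hasCompactSupport_bump N).comp_left (g := fun t : ℝ => (t : ℂ)) (by simp)).mul_left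

theorem integrable_mul_bump {g : EuclideanSpace ℝ (Fin N) → ℂ} (hg : Continuous g) :
    Integrable fun ξ => g ξ * (bump N ξ : ℂ) :=
  (continuous_mul_bump hg).integrable_of_hasCompactSupport (hasCompactSupport_mul_bump g)

theorem memLp_mul_bump {g : EuclideanSpace ℝ (Fin N) → ℂ} (hg : Continuous g) :
    MemLp (fun ξ => g ξ * (bump N ξ : ℂ)) 2 :=
  (continuous_mul_bump hg).memLp_of_hasCompactSupport (hasCompactSupport_mul_bump g)

/-- The Fourier transform of `g * B`, reflected and dilated. -/
noncomputable def window (N : ℕ) (σ : ℝ) (g : EuclideanSpace ℝ (Fin N) → ℂ)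
    (z : EuclideanSpace ℝ (Fin N)) : ℂ :=
  𝓕 (fun ξ => g ξ * (bump N ξ : ℂ)) ((-σ) • z)

theorem continuous_fourier_mul_bump {g : EuclideanSpace ℝ (Fin N) → ℂ} (hg : Continuous g) :
    Continuous (𝓕 (fun ξ => g ξ * (bump N ξ : ℂ))) :=
  VectorFourier.fourierIntegral_continuous Real.continuous_fourierChar
    (by exact continuous_inner) (integrable_mul_bump hg)

theorem continuous_window {σ : ℝ} {g : EuclideanSpace ℝ (Fin N) → ℂ} (hg : Continuous g) :
    Continuous (window N σ g) :=
  (continuous_fourier_mul_bump hg).comp (continuous_const_smul _)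

theorem integrable_norm_sq_window {σ : ℝ} (hσ : 0 < σ) {g : EuclideanSpace ℝ (Fin N) → ℂ}
    (hg : Continuous g) : Integrable fun z => ‖window N σ g z‖ ^ 2 := by
  have h := (memLp_two_fourier (integrable_mul_bump hg) (memLp_mul_bump hg)).integrable_norm_pow
    (by norm_num)
  exact h.comp_smul (by linarith : -σ ≠ 0)

theorem memLp_window {σ : ℝ} (hσ : 0 < σ) {g : EuclideanSpace ℝ (Fin N) → ℂ}
    (hg : Continuous g) : MemLp (window N σ g) 2 :=
  (memLp_two_iff_integrable_sq_norm (continuous_window hg).aestronglyMeasurable).2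
    (integrable_norm_sq_window hσ hg)

theorem integral_norm_sq_window {σ : ℝ} (hσ : 0 < σ) {g : EuclideanSpace ℝ (Fin N) → ℂ}
    (hg : Continuous g) :
    σ ^ N * ∫ z, ‖window N σ g z‖ ^ 2 = ∫ ξ, ‖g ξ‖ ^ 2 * bump N ξ ^ 2 := by
  have h := integral_norm_sq_fourier (integrable_mul_bump hg) (memLp_mul_bump hg)
  have h2 := Measure.integral_comp_smul (volume : Measure (EuclideanSpace ℝ (Fin N)))
    (fun w => ‖𝓕 (fun ξ => g ξ * (bump N ξ : ℂ)) w‖ ^ 2) (-σ)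
  unfold window
  rw [h2, h]
  have : |((-σ) ^ Module.finrank ℝ (EuclideanSpace ℝ (Fin N)))⁻¹| = (σ ^ N)⁻¹ := by
    simp [abs_inv, abs_pow, abs_of_pos hσ]
  rw [this, smul_eq_mul, mul_inv_cancel_left₀ (by positivity)]
  simp [mul_pow]

theorem window_sub {σ : ℝ} {g h : EuclideanSpace ℝ (Fin N) → ℂ} (hg : Continuous g)
    (hh : Continuous h) (z : EuclideanSpace ℝ (Fin N)) :
    window N σ (fun ξ => g ξ - h ξ) z = window N σ g z - window N σ h z := by
  unfold window
  simp only [Real.fourier_eq, sub_mul, smul_sub]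
  exact integral_sub ((Real.fourierIntegral_convergent_iff _).2 (integrable_mul_bump hg))
    ((Real.fourierIntegral_convergent_iff _).2 (integrable_mul_bump hh))

theorem window_sum {σ : ℝ} {ι : Type*} (s : Finset ι) (c : ι → ℂ)
    {g : ι → EuclideanSpace ℝ (Fin N) → ℂ} (hg : ∀ i, Continuous (g i))
    (z : EuclideanSpace ℝ (Fin N)) :
    window N σ (fun ξ => ∑ i ∈ s, c i * g i ξ) z = ∑ i ∈ s, c i * window N σ (g i) z := by
  unfold window
  simp only [Real.fourier_eq, ← integral_const_mul]
  rw [← integral_finsetSum]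
  · congr 1; funext v
    rw [Finset.sum_mul, Finset.smul_sum]
    refine Finset.sum_congr rfl fun i _ => ?_
    rw [mul_assoc, mul_smul_comm]
  · intro i _
    exact ((Real.fourierIntegral_convergent_iff _).2 (integrable_mul_bump (hg i))).const_mul _

/-- The phase by which a translation of the window by `y` acts on the frequency side. -/
noncomputable def phase (C : ℝ) (y ξ : EuclideanSpace ℝ (Fin N)) : ℝ := -(C / 2 * inner ℝ ξ y)

theorem continuous_phase (C : ℝ) (y : EuclideanSpace ℝ (Fin N)) : Continuous (phase C y) := by
  unfold phase; fun_prop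

theorem abs_phase_le {C : ℝ} (hC : 0 < C) (y : EuclideanSpace ℝ (Fin N))
    {ξ : EuclideanSpace ℝ (Fin N)} (hξ : ‖ξ‖ ≤ 1) : |phase C y ξ| ≤ C / 2 * ‖y‖ := by
  unfold phase
  rw [abs_neg, abs_mul, abs_of_pos (half_pos hC)]
  gcongr
  exact (abs_real_inner_le_norm ξ y).trans (mul_le_of_le_one_left (norm_nonneg _) hξ)

/-- The density on `ℝᴺ` that belongs to the frequency profile `g * B`. -/
noncomputable def density (N : ℕ) (C : ℝ) (g : EuclideanSpace ℝ (Fin N) → ℂ)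
    (z : EuclideanSpace ℝ (Fin N)) : ℝ :=
  (C / 2 * (2 * Real.pi)⁻¹) ^ N / (∫ ξ, bump N ξ ^ 2) *
    ‖window N (C / 2 * (2 * Real.pi)⁻¹) g z‖ ^ 2

/-- Translation by `y` becomes modulation on the frequency side, so `y` enters only through the
phase. The factor `(2π)⁻¹` in the dilation converts between the two Fourier normalizations. -/
theorem rho_sub_eq_density (C : ℝ) (y z : EuclideanSpace ℝ (Fin N)) :
    rho N C (y - z) = density N C (fun ξ => Complex.exp (phase C y ξ * Complex.I)) z := by
  have key : 𝓕 (fun ξ : EuclideanSpace ℝ (Fin N) => (bump N ξ : ℂ))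
      ((2 * Real.pi)⁻¹ • (C / 2) • (y - z)) =
      window N (C / 2 * (2 * Real.pi)⁻¹)
        (fun ξ => Complex.exp (phase C y ξ * Complex.I)) z := by
    unfold window
    rw [Real.fourier_eq', Real.fourier_eq']
    congr 1; funext ξ
    rw [smul_eq_mul, smul_eq_mul, ← mul_assoc, ← Complex.exp_add, ← add_mul]
    congr 3
    rw [← Complex.ofReal_add]
    congr 1
    simp only [phase, inner_smul_right, inner_sub_right]
    field_simp
    ring
  unfold rho rhoTwo bumpHat density
  rw [key, norm_smul, mul_pow, mul_pow]
  have h2 : ‖((√(2 * Real.pi)) ^ N)⁻¹‖ ^ 2 = ((2 * Real.pi)⁻¹) ^ N := by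
    rw [Real.norm_eq_abs, sq_abs, inv_pow, inv_pow, ← pow_mul, mul_comm N 2, pow_mul,
      Real.sq_sqrt (by positivity)]
  rw [h2]
  ring

theorem density_nonneg {C : ℝ} (hC : 0 < C) (g : EuclideanSpace ℝ (Fin N) → ℂ)
    (z : EuclideanSpace ℝ (Fin N)) : 0 ≤ density N C g z := by
  have := integral_bump_sq_pos N
  unfold density; positivity

theorem rescale_pos {C : ℝ} (hC : 0 < C) : 0 < C / 2 * (2 * Real.pi)⁻¹ := by positivity

theorem integrable_density {C : ℝ} (hC : 0 < C) {g : EuclideanSpace ℝ (Fin N) → ℂ}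
    (hg : Continuous g) : Integrable (density N C g) :=
  (integrable_norm_sq_window (rescale_pos hC) hg).const_mul _

theorem integral_density {C : ℝ} (hC : 0 < C) {g : EuclideanSpace ℝ (Fin N) → ℂ}
    (hg : Continuous g) :
    ∫ z, density N C g z = (∫ ξ, ‖g ξ‖ ^ 2 * bump N ξ ^ 2) / ∫ ξ, bump N ξ ^ 2 := by
  unfold density
  rw [integral_const_mul, ← integral_norm_sq_window (rescale_pos hC) hg]
  ring

theorem integral_density_le {C : ℝ} (hC : 0 < C) {g : EuclideanSpace ℝ (Fin N) → ℂ}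
    (hg : Continuous g) {s : ℝ} (hs : ∀ ξ, ‖ξ‖ ≤ 1 → ‖g ξ‖ ≤ s) :
    ∫ z, density N C g z ≤ s ^ 2 := by
  rw [integral_density hC hg, div_le_iff₀ (integral_bump_sq_pos N), ← integral_const_mul]
  have hi := integrable_bump_sq N
  have hi' : Integrable fun ξ => ‖g ξ‖ ^ 2 * bump N ξ ^ 2 := by
    refine ((memLp_mul_bump hg).integrable_norm_pow (by norm_num)).congr (.of_forall fun ξ => ?_)
    simp [mul_pow]
  refine integral_mono hi' (hi.const_mul _) fun ξ => ?_
  dsimp only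
  rcases le_or_gt ‖ξ‖ 1 with h | h
  · have := hs ξ h
    gcongr
  · simp [bump_eq_zero h]

theorem integral_rho_sub {C : ℝ} (hC : 0 < C) (y : EuclideanSpace ℝ (Fin N)) :
    ∫ z, rho N C (y - z) = 1 := by
  simp only [rho_sub_eq_density]
  have hc := continuous_phase C y
  rw [integral_density hC (by fun_prop)]
  simp only [Complex.norm_exp_ofReal_mul_I, one_pow, one_mul]
  exact div_self (integral_bump_sq_pos N).ne'

/-- Pointwise, ||a|² - |b|²| ≤ |a - b|(2|a| + |a - b|). Weighted AM-GM with weight `t` replaces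
Cauchy–Schwarz here, and Plancherel bounds the masses of `u` and `u - v` by 1 and `t²`. The total is
t + (1 + 1/t)t² = 2t + t². -/
theorem integral_abs_density_sub_le {C : ℝ} (hC : 0 < C) {u v : EuclideanSpace ℝ (Fin N) → ℂ}
    (hu : Continuous u) (hv : Continuous v) (hu1 : ∀ ξ, ‖u ξ‖ = 1) {s : ℝ} (hs0 : 0 ≤ s)
    (hs : ∀ ξ, ‖ξ‖ ≤ 1 → ‖u ξ - v ξ‖ ≤ s) :
    ∫ z, |density N C u z - density N C v z| ≤ 2 * s + s ^ 2 := by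
  have pos : ∀ t : ℝ, 0 < t → s ≤ t →
      ∫ z, |density N C u z - density N C v z| ≤ 2 * t + t ^ 2 := by
    intro t ht hst
    have hw : Continuous fun ξ => u ξ - v ξ := hu.sub hv
    have h1 : ∫ z, density N C u z ≤ 1 ^ 2 := integral_density_le hC hu fun ξ _ => (hu1 ξ).le
    have h2 : ∫ z, density N C (fun ξ => u ξ - v ξ) z ≤ t ^ 2 :=
      integral_density_le hC hw fun ξ h => (hs ξ h).trans hst
    have iu := integrable_density hC hu
    have iw := integrable_density hC hw
    have pt : ∀ z, |density N C u z - density N C v z| ≤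
        t * density N C u z + (1 + t⁻¹) * density N C (fun ξ => u ξ - v ξ) z := by
      intro z
      unfold density
      rw [window_sub hu hv]
      set k := (C / 2 * (2 * Real.pi)⁻¹) ^ N / (∫ ξ, bump N ξ ^ 2)
      have hk : 0 ≤ k := by
        have := integral_bump_sq_pos N
        positivity
      set a := window N (C / 2 * (2 * Real.pi)⁻¹) u z
      set b := window N (C / 2 * (2 * Real.pi)⁻¹) v z
      rw [← mul_sub, abs_mul, abs_of_nonneg hk]
      have hab : |‖a‖ ^ 2 - ‖b‖ ^ 2| ≤ t * ‖a‖ ^ 2 + (1 + t⁻¹) * ‖a - b‖ ^ 2 := by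
        have e1 : |‖a‖ - ‖b‖| ≤ ‖a - b‖ := abs_norm_sub_norm_le a b
        have e2 : ‖a‖ + ‖b‖ ≤ 2 * ‖a‖ + ‖a - b‖ := by
          have := (abs_le.1 e1).1
          linarith
        have e3 : |‖a‖ ^ 2 - ‖b‖ ^ 2| ≤ ‖a - b‖ * (2 * ‖a‖ + ‖a - b‖) := by
          rw [show ‖a‖ ^ 2 - ‖b‖ ^ 2 = (‖a‖ - ‖b‖) * (‖a‖ + ‖b‖) by ring, abs_mul,
            abs_of_nonneg (by positivity : 0 ≤ ‖a‖ + ‖b‖)]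
          gcongr
        have e4 : 2 * (‖a‖ * ‖a - b‖) ≤ t * ‖a‖ ^ 2 + t⁻¹ * ‖a - b‖ ^ 2 := by
          have : 0 ≤ t⁻¹ * (t * ‖a‖ - ‖a - b‖) ^ 2 := by positivity
          have e : t⁻¹ * (t * ‖a‖ - ‖a - b‖) ^ 2 =
              t * ‖a‖ ^ 2 + t⁻¹ * ‖a - b‖ ^ 2 - 2 * (‖a‖ * ‖a - b‖) := by
            field_simp; ring
          linarith
        linarith
      calc k * |‖a‖ ^ 2 - ‖b‖ ^ 2| ≤ k * (t * ‖a‖ ^ 2 + (1 + t⁻¹) * ‖a - b‖ ^ 2) := by gcongr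
        _ = _ := by ring
    calc _ ≤ ∫ z, t * density N C u z + (1 + t⁻¹) * density N C (fun ξ => u ξ - v ξ) z :=
          integral_mono (iu.sub (integrable_density hC hv)).abs
            ((iu.const_mul _).add (iw.const_mul _)) pt
      _ = t * (∫ z, density N C u z) + (1 + t⁻¹) * ∫ z, density N C (fun ξ => u ξ - v ξ) z := by
          rw [integral_add (iu.const_mul _) (iw.const_mul _), integral_const_mul,
            integral_const_mul]
      _ ≤ t * 1 ^ 2 + (1 + t⁻¹) * t ^ 2 := by gcongr
      _ = _ := by field_simp; ring
  -- The weight must be positive, so `s = 0` is reached by letting `t` decrease to `s`.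
  have hcont : Continuous fun t : ℝ => 2 * t + t ^ 2 := by fun_prop
  refine ge_of_tendsto (x := nhdsWithin s (Set.Ioi s)) (f := fun t : ℝ => 2 * t + t ^ 2)
    hcont.continuousWithinAt ?_
  filter_upwards [self_mem_nhdsWithin] with t ht
  exact pos t (hs0.trans_lt ht) (le_of_lt ht)

end window

end PTF

/-! ### Densities polynomial in the shift -/

namespace PTF

/-- A bound for the error of the Taylor polynomial of degree less than `l` of `x ↦ exp (i x)`. -/
noncomputable def remainder (l : ℕ) (x : ℝ) : ℝ :=
  if l = 1 then min 2 x else x ^ l / l.factorial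

theorem remainder_nonneg (l : ℕ) {x : ℝ} (hx : 0 ≤ x) : 0 ≤ remainder l x := by
  unfold remainder
  split_ifs
  · exact le_min zero_le_two hx
  · positivity

theorem remainder_le (l : ℕ) (x : ℝ) : remainder l x ≤ x ^ l / l.factorial := by
  unfold remainder
  split_ifs with h
  · subst h; simp
  · exact le_rfl

/-- For `l = 1` the remainder |exp(ix) - 1| is also at most 2. This cap lets short blocks be handled
with second moments only. -/
theorem norm_exp_mul_I_sub_sum_le_remainder (l : ℕ) (x : ℝ) :
    ‖Complex.exp (x * Complex.I) - ∑ a ∈ Finset.range l, (x * Complex.I) ^ a / a.factorial‖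
      ≤ remainder l |x| := by
  have h := norm_exp_mul_I_sub_sum_le l x
  unfold remainder
  split_ifs with h1
  · subst h1
    refine le_min ((norm_sub_le _ _).trans ?_) (by simpa using h)
    rw [Complex.norm_exp_ofReal_mul_I]
    norm_num
  · exact h

theorem remainder_mono (l : ℕ) {x y : ℝ} (hx : 0 ≤ x) (hxy : x ≤ y) :
    remainder l x ≤ remainder l y := by
  unfold remainder
  split_ifs <;> gcongr

theorem exists_polynomial_density {N : ℕ} {C : ℝ} (hC : 0 < C) (l : ℕ) :
    ∃ (ι : Type) (_ : Fintype ι) (q : ι → List (Fin N))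
      (β : ι → EuclideanSpace ℝ (Fin N) → ℝ),
      (∀ p, (q p).length ≤ 2 * (l - 1)) ∧ (∀ p, Integrable (β p)) ∧
      ∀ y : EuclideanSpace ℝ (Fin N),
        ∫ z, |rho N C (y - z) - ∑ p, ((q p).map fun j => y j).prod * β p z| ≤
          2 * remainder l (C / 2 * ‖y‖) + remainder l (C / 2 * ‖y‖) ^ 2 := by
  -- The index set consists of words of length less than `l` in the coordinates: expanding ⟨ξ, y⟩^a
  -- produces one monomial in `y` for each word of length `a`. The squared modulus then runs over
  -- pairs of words, which doubles the degree.
  let ι₀ := Σ a : Fin l, (Fin a → Fin N)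
  let g : ι₀ → EuclideanSpace ℝ (Fin N) → ℂ := fun p ξ =>
    (-(C / 2 : ℝ) * Complex.I) ^ (p.1 : ℕ) / (p.1 : ℕ).factorial * ∏ k, (ξ (p.2 k) : ℂ)
  have hg : ∀ p, Continuous (g p) := fun p => by fun_prop
  let σ := C / 2 * (2 * Real.pi)⁻¹
  have hσ : 0 < σ := rescale_pos hC
  let κ := σ ^ N / ∫ ξ, bump N ξ ^ 2
  let c : ι₀ → EuclideanSpace ℝ (Fin N) → ℝ := fun p y => ((List.ofFn p.2).map fun j => y j).prod
  have hv : ∀ y ξ, ∑ a ∈ Finset.range l, ((phase C y ξ : ℂ) * Complex.I) ^ a / a.factorial =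
      ∑ p, (c p y : ℂ) * g p ξ := by
    intro y ξ
    rw [Fintype.sum_sigma, Finset.sum_range]
    refine Finset.sum_congr rfl fun a _ => ?_
    have e : ((phase C y ξ : ℂ) * Complex.I) =
        (-(C / 2 : ℝ) * Complex.I) * ∑ j, ((y j : ℂ) * (ξ j : ℂ)) := by
      simp only [phase, PiLp.inner_apply, RCLike.inner_apply, conj_trivial]
      push_cast
      ring
    rw [e, mul_pow, Fintype.sum_pow, Finset.mul_sum, Finset.sum_div]
    refine Finset.sum_congr rfl fun t _ => ?_
    simp only [c, g, List.map_ofFn, List.prod_ofFn, Function.comp_apply, Finset.prod_mul_distrib]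
    push_cast
    ring
  refine ⟨ι₀ × ι₀, inferInstance, fun p => List.ofFn p.1.2 ++ List.ofFn p.2.2,
    fun p z => κ * (window N σ (g p.1) z * starRingEnd ℂ (window N σ (g p.2) z)).re, ?_, ?_, ?_⟩
  · intro p
    have h1 := p.1.1.2
    have h2 := p.2.1.2
    rw [List.length_append, List.length_ofFn, List.length_ofFn]
    omega
  · intro p
    have := (memLp_window hσ (hg p.1)).integrable_mul (memLp_window hσ (hg p.2)).star
    exact this.re.const_mul _
  · intro y
    have hc := continuous_phase C y
    have hdens : ∀ z, ∑ p : ι₀ × ι₀,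
        ((List.ofFn p.1.2 ++ List.ofFn p.2.2).map fun j => y j).prod *
          (κ * (window N σ (g p.1) z * starRingEnd ℂ (window N σ (g p.2) z)).re) =
        density N C (fun ξ => ∑ a ∈ Finset.range l,
          ((phase C y ξ : ℂ) * Complex.I) ^ a / a.factorial) z := by
      intro z
      simp only [hv]
      unfold density
      rw [window_sum _ _ hg]
      have : ∀ w : ℂ, ‖w‖ ^ 2 = (w * starRingEnd ℂ w).re := fun w => by
        rw [Complex.mul_conj, Complex.ofReal_re, Complex.normSq_eq_norm_sq]
      rw [this, map_sum, Finset.sum_mul_sum, ← Finset.sum_product', Finset.univ_product_univ,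
        Complex.re_sum, Finset.mul_sum]
      refine Finset.sum_congr rfl fun p _ => ?_
      rw [List.map_append, List.prod_append, map_mul, Complex.conj_ofReal,
        mul_mul_mul_comm (c p.1 y : ℂ), ← Complex.ofReal_mul, Complex.re_ofReal_mul]
      simp only [c, κ, σ]
      ring
    simp only [hdens, rho_sub_eq_density]
    refine integral_abs_density_sub_le hC (by fun_prop) (by fun_prop)
      (fun ξ => Complex.norm_exp_ofReal_mul_I _) (remainder_nonneg _ (by positivity)) ?_
    intro ξ hξ
    exact (norm_exp_mul_I_sub_sum_le_remainder l _).trans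
      (remainder_mono l (abs_nonneg _) (abs_phase_le hC y hξ))

end PTF

/-! ### Products over the blocks -/

/-- Telescoping one factor at a time. The bound is a difference of two products, so its integral
over a product space factorizes. -/
theorem abs_prod_sub_prod_le {ι : Type*} (s : Finset ι) (a b : ι → ℝ) :
    |∏ i ∈ s, a i - ∏ i ∈ s, b i| ≤ ∏ i ∈ s, (|a i| + |a i - b i|) - ∏ i ∈ s, |a i| := by
  classical
  induction s using Finset.induction_on with
  | empty => simp
  | insert j s hj ih =>
    simp only [Finset.prod_insert hj]
    have hb : |∏ i ∈ s, b i| ≤ ∏ i ∈ s, (|a i| + |a i - b i|) := by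
      rw [Finset.abs_prod]
      refine Finset.prod_le_prod (fun _ _ => abs_nonneg _) fun i _ => ?_
      have := abs_sub_abs_le_abs_sub (b i) (a i)
      rw [abs_sub_comm] at this
      linarith
    calc |a j * ∏ i ∈ s, a i - b j * ∏ i ∈ s, b i|
        = |a j * (∏ i ∈ s, a i - ∏ i ∈ s, b i) + (a j - b j) * ∏ i ∈ s, b i| := by ring_nf
      _ ≤ |a j| * |∏ i ∈ s, a i - ∏ i ∈ s, b i| + |a j - b j| * |∏ i ∈ s, b i| := by
        rw [← abs_mul, ← abs_mul]; exact abs_add_le _ _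
      _ ≤ |a j| * (∏ i ∈ s, (|a i| + |a i - b i|) - ∏ i ∈ s, |a i|) +
          |a j - b j| * ∏ i ∈ s, (|a i| + |a i - b i|) := by gcongr
      _ = _ := by ring

theorem integral_abs_prod_sub_prod_le {ι : Type*} [Fintype ι] {E : ι → Type*}
    [∀ i, MeasureSpace (E i)] [∀ i, SigmaFinite (volume : Measure (E i))]
    {a b : (i : ι) → E i → ℝ} (ha : ∀ i, Integrable (a i)) (hb : ∀ i, Integrable (b i))
    (ha0 : ∀ i z, 0 ≤ a i z) (ha1 : ∀ i, ∫ z, a i z = 1) {t : ι → ℝ}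
    (ht : ∀ i, ∫ z, |a i z - b i z| ≤ t i) :
    ∫ z : (i : ι) → E i, |∏ i, a i (z i) - ∏ i, b i (z i)| ≤ ∏ i, (1 + t i) - 1 := by
  have ia : Integrable fun z : (i : ι) → E i => ∏ i, a i (z i) := Integrable.fintype_prod_dep ha
  have ib : Integrable fun z : (i : ι) → E i => ∏ i, b i (z i) := Integrable.fintype_prod_dep hb
  have ic : ∀ i, Integrable fun z => a i z + |a i z - b i z| := fun i =>
    (ha i).add ((ha i).sub (hb i)).abs
  have iC : Integrable fun z : (i : ι) → E i => ∏ i, (a i (z i) + |a i (z i) - b i (z i)|) :=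
    Integrable.fintype_prod_dep ic
  calc _ ≤ ∫ z : (i : ι) → E i,
        (∏ i, (a i (z i) + |a i (z i) - b i (z i)|) - ∏ i, a i (z i)) := by
        refine integral_mono (ia.sub ib).abs (iC.sub ia) fun z => ?_
        have := abs_prod_sub_prod_le Finset.univ (fun i => a i (z i)) (fun i => b i (z i))
        simpa only [abs_of_nonneg (ha0 _ _)] using this
    _ = ∏ i, (∫ z, (a i z + |a i z - b i z|)) - ∏ i, ∫ z, a i z := by
        rw [integral_sub iC ia, integral_fintype_prod_volume_eq_prod,
          integral_fintype_prod_volume_eq_prod (fun i z => a i z + |a i z - b i z|)]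
    _ ≤ _ := by
        simp only [ha1, Finset.prod_const_one]
        gcongr with i
        · exact fun i _ => integral_nonneg fun z => add_nonneg (ha0 i z) (abs_nonneg _)
        · have hi : Integrable fun z => |a i z - b i z| := ((ha i).sub (hb i)).abs
          rw [integral_add (ha i) hi, ha1]
          linarith [ht i]

namespace PTF

/-- Multiplying out the block densities leaves monomials in `y`, whose coefficients are integrals of
`f` against the products of the `β`. Since 1 + (2s + s²) = (1 + s)², the L¹ errors combine into the
stated product. -/
theorem exists_polynomial_approx {d : ℕ} {N : Fin d → ℕ} {C : Fin d → ℝ} (hC : ∀ i, 0 < C i)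
    (l : Fin d → ℕ) {f : ((i : Fin d) → EuclideanSpace ℝ (Fin (N i))) → ℝ} (hf : Measurable f)
    (hf1 : ∀ z, |f z| ≤ 1) :
    ∃ (ι : Fin d → Type) (_ : ∀ i, Fintype (ι i)) (q : (i : Fin d) → ι i → List (Fin (N i)))
      (c : ((i : Fin d) → ι i) → ℝ), (∀ i p, (q i p).length ≤ 2 * (l i - 1)) ∧
      ∀ y : (i : Fin d) → EuclideanSpace ℝ (Fin (N i)),
        |(∫ z, f z * rhoProd N C (y - z)) -
          ∑ p, c p * ∏ i, ((q i (p i)).map fun j => y i j).prod| ≤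
          ∏ i, (1 + remainder (l i) (C i / 2 * ‖y i‖)) ^ 2 - 1 := by
  choose ι hι q β hq hβ hy using fun i => exists_polynomial_density (N := N i) (hC i) (l i)
  refine ⟨ι, hι, q, fun p => ∫ z, f z * ∏ i, β i (p i) (z i), hq, fun y => ?_⟩
  have hmul : ∀ {u : ((i : Fin d) → EuclideanSpace ℝ (Fin (N i))) → ℝ}, Integrable u →
      Integrable fun z => f z * u z := fun hu =>
    hu.bdd_mul (c := 1) hf.aestronglyMeasurable (.of_forall hf1)
  let a : (i : Fin d) → EuclideanSpace ℝ (Fin (N i)) → ℝ := fun i z => rho (N i) (C i) (y i - z)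
  let b : (i : Fin d) → EuclideanSpace ℝ (Fin (N i)) → ℝ := fun i z =>
    ∑ p, ((q i p).map fun j => y i j).prod * β i p z
  have ha : ∀ i, Integrable (a i) := fun i => by
    have hc := continuous_phase (C i) (y i)
    simp only [a, rho_sub_eq_density]
    exact integrable_density (hC i) (by fun_prop)
  have hb : ∀ i, Integrable (b i) := fun i =>
    integrable_finsetSum _ fun p _ => (hβ i p).const_mul _
  have ia : Integrable fun z : (i : Fin d) → EuclideanSpace ℝ (Fin (N i)) => ∏ i, a i (z i) :=
    Integrable.fintype_prod_dep ha
  have ib : Integrable fun z : (i : Fin d) → EuclideanSpace ℝ (Fin (N i)) => ∏ i, b i (z i) :=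
    Integrable.fintype_prod_dep hb
  have hT : ∑ p : (i : Fin d) → ι i, (∫ z, f z * ∏ i, β i (p i) (z i)) *
      ∏ i, ((q i (p i)).map fun j => y i j).prod = ∫ z, f z * ∏ i, b i (z i) := by
    simp only [b, Fintype.prod_sum, Finset.mul_sum]
    rw [integral_finsetSum]
    · refine Finset.sum_congr rfl fun p _ => ?_
      rw [← integral_mul_const]
      congr 1; funext z
      rw [Finset.prod_mul_distrib]
      ring
    · intro p _
      exact hmul (Integrable.fintype_prod_dep fun i => (hβ i (p i)).const_mul _)
  rw [hT]
  have hr : ∀ z, rhoProd N C (y - z) = ∏ i, a i (z i) := fun z => rfl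
  simp only [hr]
  rw [← integral_sub (hmul ia) (hmul ib)]
  refine abs_integral_le_integral_abs.trans ?_
  calc _ ≤ ∫ z : (i : Fin d) → EuclideanSpace ℝ (Fin (N i)),
        |∏ i, a i (z i) - ∏ i, b i (z i)| := by
        refine integral_mono ((hmul ia).sub (hmul ib)).abs (ia.sub ib).abs fun z => ?_
        dsimp only
        rw [← mul_sub, abs_mul]
        exact mul_le_of_le_one_left (abs_nonneg _) (hf1 z)
    _ ≤ ∏ i, (1 + (2 * remainder (l i) (C i / 2 * ‖y i‖) +
          remainder (l i) (C i / 2 * ‖y i‖) ^ 2)) - 1 := by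
        refine integral_abs_prod_sub_prod_le ha hb (fun i z => ?_)
          (fun i => integral_rho_sub (hC i) _) fun i => hy i (y i)
        simp only [a, rho_sub_eq_density]
        exact density_nonneg (hC i) _ _
    _ = _ := by
        congr 1
        refine Finset.prod_congr rfl fun i _ => ?_
        ring

end PTF

/-! ### Moments under limited independence -/

namespace PTF

theorem integrable_pow_gaussianReal (q : ℕ) :
    Integrable (fun x : ℝ => x ^ q) (gaussianReal 0 1) := by
  have h := (memLp_id_gaussianReal' (μ := 0) (v := 1) (q : ENNReal) (by simp)).integrable_norm_pow'
  refine (integrable_norm_iff (by fun_prop)).1 (h.congr (.of_forall fun x => ?_))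
  simp

theorem IsKIndepGaussian.integral_prod_pow {Ω : Type*} [MeasurableSpace Ω] {μ : Measure Ω}
    [IsProbabilityMeasure μ] {k n : ℕ} {X : Fin n → Ω → ℝ} (h : IsKIndepGaussian μ k X)
    (s : Fin n →₀ ℕ) (hs : s.support.card ≤ k) :
    Integrable (fun ω => ∏ j ∈ s.support, X j ω ^ s j) μ ∧
      ∫ ω, ∏ j ∈ s.support, X j ω ^ s j ∂μ =
        ∏ j ∈ s.support, ∫ x, x ^ s j ∂(gaussianReal 0 1) := by
  have hm : ∀ j : s.support, AEMeasurable (X j) μ := fun j => (h.1 j).aemeasurable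
  have hmap : μ.map (fun ω (j : s.support) => X j ω) =
      Measure.pi fun _ : s.support => gaussianReal 0 1 := by
    rw [(h.2 s.support hs).map_fun_eq_pi_map hm]
    congr 1; funext j
    exact (h.1 j).map_eq
  have hX : AEMeasurable (fun ω (j : s.support) => X j ω) μ := aemeasurable_pi_lambda _ hm
  have hi : Integrable (fun x : s.support → ℝ => ∏ j, x j ^ s j)
      (μ.map fun ω (j : s.support) => X j ω) := by
    rw [hmap]
    exact Integrable.fintype_prod (f := fun (j : s.support) (x : ℝ) => x ^ s j)
      fun j => integrable_pow_gaussianReal _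
  have e : ∀ ω, ∏ j ∈ s.support, X j ω ^ s j = ∏ j : s.support, X j ω ^ s j := fun ω =>
    (Finset.prod_coe_sort s.support fun j => X j ω ^ s j).symm
  simp only [e]
  refine ⟨hi.comp_aemeasurable hX, ?_⟩
  rw [← integral_map (f := fun x : s.support → ℝ => ∏ j, x j ^ s j) hX hi.aestronglyMeasurable,
    hmap, integral_fintype_prod_eq_prod (fun (j : s.support) (x : ℝ) => x ^ s j)]
  exact Finset.prod_coe_sort s.support fun j => ∫ x, x ^ s j ∂(gaussianReal 0 1)

theorem card_support_le_totalDegree {n : ℕ} {Q : MvPolynomial (Fin n) ℝ} {s : Fin n →₀ ℕ}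
    (hs : s ∈ Q.support) : s.support.card ≤ Q.totalDegree := by
  refine le_trans ?_ (MvPolynomial.le_totalDegree hs)
  rw [Finsupp.sum, Finset.card_eq_sum_ones]
  exact Finset.sum_le_sum fun j hj => Nat.one_le_iff_ne_zero.2 (Finsupp.mem_support_iff.1 hj)

theorem IsKIndepGaussian.integral_eval_eq_sum {Ω : Type*} [MeasurableSpace Ω] {μ : Measure Ω}
    [IsProbabilityMeasure μ] {k n : ℕ} {X : Fin n → Ω → ℝ} (h : IsKIndepGaussian μ k X)
    {Q : MvPolynomial (Fin n) ℝ} (hQ : Q.totalDegree ≤ k) :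
    Integrable (fun ω => MvPolynomial.eval (fun j => X j ω) Q) μ ∧
      ∫ ω, MvPolynomial.eval (fun j => X j ω) Q ∂μ =
        ∑ s ∈ Q.support, Q.coeff s * ∏ j ∈ s.support, ∫ x, x ^ s j ∂(gaussianReal 0 1) := by
  have key := fun s (hs : s ∈ Q.support) =>
    h.integral_prod_pow s ((card_support_le_totalDegree hs).trans hQ)
  simp only [MvPolynomial.eval_eq]
  refine ⟨integrable_finsetSum _ fun s hs => (key s hs).1.const_mul _, ?_⟩
  rw [integral_finsetSum _ fun s hs => (key s hs).1.const_mul _]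
  refine Finset.sum_congr rfl fun s hs => ?_
  rw [integral_const_mul, (key s hs).2]

instance (n : ℕ) : IsProbabilityMeasure (stdGaussian n) := by
  unfold stdGaussian; infer_instance

theorem isKIndepGaussian_stdGaussian (k n : ℕ) :
    IsKIndepGaussian (stdGaussian n) k fun j (x : Fin n → ℝ) => x j := by
  refine ⟨fun j => ⟨(measurable_pi_apply j).aemeasurable, ?_⟩, fun S _ => ?_⟩
  · exact (measurePreserving_eval (fun _ : Fin n => gaussianReal 0 1) j).map_eq
  · have h : iIndepFun (fun (j : Fin n) (x : Fin n → ℝ) => x j) (stdGaussian n) :=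
      iIndepFun_pi (X := fun _ (x : ℝ) => x) fun _ => aemeasurable_id
    exact h.precomp Subtype.val_injective

/-- A monomial of degree at most `k` involves at most `k` variables, so its expectation factorizes
into one-dimensional Gaussian moments under either law. -/
theorem IsKIndepGaussian.integral_eval {Ω : Type*} [MeasurableSpace Ω] {μ : Measure Ω}
    [IsProbabilityMeasure μ] {k n : ℕ} {X : Fin n → Ω → ℝ} (h : IsKIndepGaussian μ k X)
    {Q : MvPolynomial (Fin n) ℝ} (hQ : Q.totalDegree ≤ k) :
    ∫ ω, MvPolynomial.eval (fun j => X j ω) Q ∂μ =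
      ∫ y, MvPolynomial.eval y Q ∂(stdGaussian n) := by
  rw [(h.integral_eval_eq_sum hQ).2, ((isKIndepGaussian_stdGaussian k n).integral_eval_eq_sum hQ).2]

/-! ### Polynomial approximation of the mollified threshold function -/

theorem continuous_rho (N : ℕ) (C : ℝ) : Continuous (rho N C) := by
  have h : Continuous (𝓕 (fun ξ : EuclideanSpace ℝ (Fin N) => (bump N ξ : ℂ))) := by
    simpa using continuous_fourier_mul_bump (N := N) (g := fun _ => 1) continuous_const
  unfold rho rhoTwo bumpHat
  fun_prop

theorem continuous_rhoProd {d : ℕ} (N : Fin d → ℕ) (C : Fin d → ℝ) : Continuous (rhoProd N C) := by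
  have := fun i => continuous_rho (N i) (C i)
  unfold rhoProd
  fun_prop

theorem measurable_sign : Measurable Real.sign := by
  unfold Real.sign
  exact Measurable.ite measurableSet_Iio measurable_const
    (Measurable.ite measurableSet_Ioi measurable_const measurable_const)

theorem abs_sign_le_one (x : ℝ) : |Real.sign x| ≤ 1 := by
  rcases Real.sign_apply_eq x with h | h | h <;> simp [h]

theorem totalDegree_prod_map_le {σ τ : Type*} {P : τ → MvPolynomial σ ℝ} {d : ℕ}
    (hP : ∀ j, (P j).totalDegree ≤ d) (q : List τ) : ((q.map P).prod).totalDegree ≤ q.length * d := by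
  induction q with
  | nil => simp
  | cons j q ih =>
    rw [List.map_cons, List.prod_cons, List.length_cons]
    refine (MvPolynomial.totalDegree_mul _ _).trans ?_
    have := hP j
    linarith

namespace Decomposition

variable {d n : ℕ} {A : ℝ} {m : Fin d → ℕ} {p : MvPolynomial (Fin n) ℝ}

theorem measurable_f (D : Decomposition d n A m p) : Measurable D.f := by
  have h : Continuous fun y : (i : Fin d) → EuclideanSpace ℝ (Fin (D.N i)) =>
      ∑ i, MvPolynomial.eval (fun j => y i j) (D.h i) := by
    refine continuous_finsetSum _ fun i _ => ?_
    exact (MvPolynomial.continuous_eval (D.h i)).comp (by fun_prop)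
  exact measurable_sign.comp h.measurable

theorem abs_f_le_one (D : Decomposition d n A m p)
    (y : (i : Fin d) → EuclideanSpace ℝ (Fin (D.N i))) : |D.f y| ≤ 1 :=
  abs_sign_le_one _

theorem fTilde_eq (D : Decomposition d n A m p) (C : Fin d → ℝ)
    (y : (i : Fin d) → EuclideanSpace ℝ (Fin (D.N i))) :
    D.fTilde C y = ∫ z, D.f z * rhoProd D.N C (y - z) := by
  unfold fTilde
  rw [convolution_def]
  simp

theorem measurable_fTilde (D : Decomposition d n A m p) (C : Fin d → ℝ) :
    Measurable (D.fTilde C) := by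
  have h : Measurable (Function.uncurry fun y z => D.f z * rhoProd D.N C (y - z)) :=
    (D.measurable_f.comp measurable_snd).mul
      ((continuous_rhoProd D.N C).measurable.comp (measurable_fst.sub measurable_snd))
  have := (h.stronglyMeasurable.integral_prod_right
    (ν := (volume : Measure ((i : Fin d) → EuclideanSpace ℝ (Fin (D.N i)))))).measurable
  rwa [show D.fTilde C = _ from funext (D.fTilde_eq C)]

theorem measurable_FTilde (D : Decomposition d n A m p) (C : Fin d → ℝ) :
    Measurable (D.FTilde C) := by
  refine (D.measurable_fTilde C).comp ?_
  have h : Continuous D.PVec := by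
    refine continuous_pi fun i => ?_
    refine (PiLp.continuous_toLp 2 _).comp ?_
    exact continuous_pi fun j => MvPolynomial.continuous_eval _
  exact h.measurable

open Classical in
/-- The inner polynomials, with those replaced by zero that do not enter into `p`. -/
noncomputable def usedP (D : Decomposition d n A m p) (i : Fin d) (j : Fin (D.N i)) :
    MvPolynomial (Fin n) ℝ :=
  if ∃ s ∈ (D.h i).support, j ∈ s.support then D.P i j else 0

theorem usedP_of_mem (D : Decomposition d n A m p) {i : Fin d} {j : Fin (D.N i)}
    (h : ∃ s ∈ (D.h i).support, j ∈ s.support) : D.usedP i j = D.P i j := by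
  unfold usedP
  exact if_pos h

/-- The field `monomial_degree` controls only those inner polynomials whose variable occurs in `h
i`. The others may have any degree, which is why they are replaced by zero. -/
theorem totalDegree_usedP_le (D : Decomposition d n A m p) (i : Fin d) (j : Fin (D.N i)) :
    (D.usedP i j).totalDegree ≤ d := by
  unfold usedP
  split_ifs with h
  · obtain ⟨s, hs, hj⟩ := h
    exact (Finset.single_le_sum (f := fun j => (D.P i j).totalDegree)
      (fun _ _ => Nat.zero_le _) hj).trans (D.monomial_degree i s hs)
  · simp

theorem moment_usedP (D : Decomposition d n A m p) (i : Fin d) (j : Fin (D.N i)) {r : ℕ}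
    (hr : 2 * r ≤ d * m i) :
    ∫ y, MvPolynomial.eval y (D.usedP i j) ^ (2 * r) ∂(stdGaussian n) ≤
      (A * √((2 * r : ℕ) : ℝ)) ^ (2 * r) := by
  unfold usedP
  split_ifs with h
  · refine le_of_eq_of_le (integral_congr_ae (.of_forall fun y => ?_)) (D.moment i j (2 * r) hr)
    simp only [pow_mul, sq_abs]
  · rcases Nat.eq_zero_or_pos r with rfl | hr
    · simp
    · simp only [map_zero, ne_eq, mul_eq_zero, OfNat.ofNat_ne_zero, hr.ne', or_self,
        not_false_eq_true, zero_pow, integral_zero]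
      rw [pow_mul]
      positivity

theorem fTilde_eq_swap (D : Decomposition d n A m p) (C : Fin d → ℝ)
    (y : (i : Fin d) → EuclideanSpace ℝ (Fin (D.N i))) :
    D.fTilde C y = ∫ z, D.f (y - z) * rhoProd D.N C z := by
  have : (volume : Measure ((i : Fin d) → EuclideanSpace ℝ (Fin (D.N i)))).IsNegInvariant :=
    Measure.pi.isNegInvariant _
  unfold fTilde
  rw [convolution_eq_swap]
  simp

theorem f_congr (D : Decomposition d n A m p)
    {y y' : (i : Fin d) → EuclideanSpace ℝ (Fin (D.N i))}
    (h : ∀ i j, (∃ s ∈ (D.h i).support, j ∈ s.support) → y i j = y' i j) : D.f y = D.f y' := by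
  unfold f
  congr 1
  refine Finset.sum_congr rfl fun i _ => ?_
  refine MvPolynomial.eval₂Hom_congr' rfl (fun j hj _ => ?_) rfl
  exact h i j ((MvPolynomial.mem_vars_iff_mem_support j).1 hj)

/-- With the convolution written so that `f` carries the shift, coordinates on which `f` does not
depend can be changed freely. -/
theorem FTilde_eq_usedP (D : Decomposition d n A m p) (C : Fin d → ℝ) (x : Fin n → ℝ) :
    D.FTilde C x = D.fTilde C
      (fun i => WithLp.toLp 2 fun j => MvPolynomial.eval x (D.usedP i j)) := by
  unfold FTilde
  rw [D.fTilde_eq_swap, D.fTilde_eq_swap]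
  have h : ∀ z, D.f (D.PVec x - z) =
      D.f ((fun i => WithLp.toLp 2 fun j => MvPolynomial.eval x (D.usedP i j)) - z) := by
    intro z
    refine D.f_congr fun i j hij => ?_
    change MvPolynomial.eval x (D.P i j) - z i j = MvPolynomial.eval x (D.usedP i j) - z i j
    rw [D.usedP_of_mem hij]
  simp only [h]

theorem exists_polynomial_FTilde (D : Decomposition d n A m p) {C : Fin d → ℝ}
    (hC : ∀ i, 0 < C i) (l : Fin d → ℕ) :
    ∃ Q : MvPolynomial (Fin n) ℝ, Q.totalDegree ≤ ∑ i, 2 * (l i - 1) * d ∧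
      ∀ x, |D.FTilde C x - MvPolynomial.eval x Q| ≤
        ∏ i, (1 + remainder (l i) (C i / 2 * ‖(WithLp.toLp 2 fun j =>
          MvPolynomial.eval x (D.usedP i j) : EuclideanSpace ℝ (Fin (D.N i)))‖)) ^ 2 - 1 := by
  obtain ⟨ι, _, q, c, hq, hc⟩ := exists_polynomial_approx hC l D.measurable_f D.abs_f_le_one
  refine ⟨∑ t, MvPolynomial.C (c t) * ∏ i, ((q i (t i)).map (D.usedP i)).prod, ?_, fun x => ?_⟩
  · refine MvPolynomial.totalDegree_finsetSum_le fun t _ => ?_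
    refine (MvPolynomial.totalDegree_mul _ _).trans ?_
    rw [MvPolynomial.totalDegree_C, zero_add]
    refine (MvPolynomial.totalDegree_finsetProd _ _).trans (Finset.sum_le_sum fun i _ => ?_)
    exact (totalDegree_prod_map_le (D.totalDegree_usedP_le i) _).trans
      (Nat.mul_le_mul_right _ (hq i _))
  · rw [D.FTilde_eq_usedP, D.fTilde_eq]
    convert! hc _ using 4
    simp [map_sum, map_mul, map_prod, map_list_prod, List.map_map, Function.comp_def]

end Decomposition

end PTF

/-! ### Elementary inequalities -/

theorem one_add_pow_le_of_le_one {x : ℝ} (h0 : 0 ≤ x) (h1 : x ≤ 1) (n : ℕ) :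
    (1 + x) ^ n ≤ 1 + (2 ^ n - 1) * x := by
  induction n with
  | zero => simp
  | succ n ih =>
    have h2 : (1 : ℝ) ≤ 2 ^ n := one_le_pow₀ one_le_two
    calc (1 + x) ^ (n + 1) ≤ (1 + (2 ^ n - 1) * x) * (1 + x) := by rw [pow_succ]; gcongr
      _ = 1 + 2 ^ n * x + (2 ^ n - 1) * (x * x) := by ring
      _ ≤ 1 + 2 ^ n * x + (2 ^ n - 1) * (x * 1) := by
        have : 0 ≤ (2 : ℝ) ^ n - 1 := by linarith
        gcongr
      _ = _ := by ring

theorem one_add_pow_sub_one_le {x : ℝ} (h0 : 0 ≤ x) (n : ℕ) :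
    (1 + x) ^ n - 1 ≤ 2 ^ n * (x + x ^ n) := by
  rcases le_total x 1 with h | h
  · have := one_add_pow_le_of_le_one h0 h n
    have : 0 ≤ 2 ^ n * x ^ n := by positivity
    nlinarith
  · have : (1 + x) ^ n ≤ (2 * x) ^ n := by gcongr; linarith
    rw [mul_pow] at this
    have : 0 ≤ 2 ^ n * x := by positivity
    linarith

/-- Replacing every factor by the largest one removes the mixed products. Only moments of single
blocks are needed afterwards. -/
theorem prod_one_add_sq_sub_one_le {d : ℕ} (s : Fin d → ℝ) (hs : ∀ i, 0 ≤ s i) :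
    ∏ i, (1 + s i) ^ 2 - 1 ≤ 4 ^ d * ∑ i, (s i + s i ^ (2 * d)) := by
  rcases isEmpty_or_nonempty (Fin d) with he | he
  · simp
  · obtain ⟨i₀, hi₀⟩ := Finite.exists_max s
    calc ∏ i, (1 + s i) ^ 2 - 1 ≤ ∏ _i : Fin d, (1 + s i₀) ^ 2 - 1 := by
          gcongr with i
          · have := hs i
            positivity
          · exact hi₀ i
      _ = (1 + s i₀) ^ (2 * d) - 1 := by simp [pow_mul]
      _ ≤ 2 ^ (2 * d) * (s i₀ + s i₀ ^ (2 * d)) := one_add_pow_sub_one_le (hs i₀) _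
      _ ≤ 4 ^ d * ∑ i, (s i + s i ^ (2 * d)) := by
          rw [pow_mul]
          norm_num
          exact Finset.single_le_sum (f := fun i => s i + s i ^ (2 * d))
            (fun i _ => by have := hs i; positivity) (Finset.mem_univ i₀)

/-- This trades a first power for a high one, whose exponent can be made even and hence polynomial
in the coordinates. -/
theorem le_add_pow_div {s t : ℝ} (hs : 0 ≤ s) (ht : 0 < t) (q : ℕ) :
    s ≤ t + s ^ (q + 1) / t ^ q := by
  rcases le_total s t with h | h
  · have : 0 ≤ s ^ (q + 1) / t ^ q := by positivity
    linarith
  · have : s ≤ s ^ (q + 1) / t ^ q := by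
      rw [le_div_iff₀ (by positivity), pow_succ']
      gcongr
    linarith

theorem norm_pow_two_mul_le {N r : ℕ} (hr : 0 < r) (y : EuclideanSpace ℝ (Fin N)) :
    ‖y‖ ^ (2 * r) ≤ (N : ℝ) ^ (r - 1) * ∑ j, y j ^ (2 * r) := by
  obtain ⟨q, rfl⟩ : ∃ q, r = q + 1 := ⟨r - 1, by omega⟩
  rw [pow_mul, EuclideanSpace.real_norm_sq_eq]
  rcases Nat.eq_zero_or_pos N with rfl | hN
  · simp
  · have h := pow_sum_div_card_le_sum_pow (s := (Finset.univ : Finset (Fin N)))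
      (f := fun j => y j ^ 2) (fun j _ => sq_nonneg _) q
    rw [div_le_iff₀ (by simp; positivity)] at h
    simp only [Finset.card_univ, Fintype.card_fin, ← pow_mul] at h
    rw [Nat.add_sub_cancel, mul_comm]
    exact h

/-! ### Error of a single block -/

namespace PTF

/-- The power `s ^ (2 * d)` is at most a multiple of the sum of the y_j^(2dl). Inserting the moment
bounds gives at most (C²/4 · N · A² · 2dl)^(dl) / l!^(2d). By the choice of `K` the base is at most
τ²(l/e)², and l! ≥ (l/e)^l then leaves τ^(2dl). Splitting `s` at the threshold `t = τ ^ l` turns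
this into t + 2t. -/
theorem large_block_bound {d : ℕ} (hd : 0 < d) {A τ K : ℝ} (hτ : 0 < τ) (hτ1 : τ ≤ 1)
    (hK : A ^ 2 * (2 * d ^ 2 * Real.exp 1 ^ 2) ≤ K * τ ^ 2) {N m l : ℕ} (hN : 0 < N) {C : ℝ}
    (hC : 0 < C) (hl : 0 < l) (hml : m ≤ 4 * d * l) (hm : K * (N * C ^ 2) ≤ m) :
    ∃ a b : ℝ, 0 ≤ b ∧
      (∀ y : EuclideanSpace ℝ (Fin N), remainder l (C / 2 * ‖y‖) +
        remainder l (C / 2 * ‖y‖) ^ (2 * d) ≤ a + b * ∑ j, y j ^ (2 * (d * l))) ∧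
      a + b * (N * (A * √((2 * (d * l) : ℕ) : ℝ)) ^ (2 * (d * l))) ≤ 3 * τ ^ l := by
  have hfac : (0 : ℝ) < l.factorial := by exact_mod_cast l.factorial_pos
  have hN' : (0 : ℝ) < N := by exact_mod_cast hN
  have hd' : (0 : ℝ) < d := by exact_mod_cast hd
  have hl' : (0 : ℝ) < l := by exact_mod_cast hl
  have hr : 0 < d * l := Nat.mul_pos hd hl
  set t := τ ^ l with ht
  have ht0 : 0 < t := by positivity
  have ht1 : t ≤ 1 := pow_le_one₀ hτ.le hτ1
  set r := d * l with hrdef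
  set B : ℝ := (C / 2) ^ (2 * r) * (N : ℝ) ^ (r - 1) / (l.factorial : ℝ) ^ (2 * d) with hB
  have hB0 : 0 ≤ B := by positivity
  refine ⟨t, 2 / t ^ (2 * d - 1) * B, by positivity, fun y => ?_, ?_⟩
  · have h0 := remainder_nonneg l (x := C / 2 * ‖y‖) (by positivity)
    set s := remainder l (C / 2 * ‖y‖)
    have h1 : s ^ (2 * d) ≤ B * ∑ j, y j ^ (2 * r) := by
      calc s ^ (2 * d) ≤ ((C / 2 * ‖y‖) ^ l / l.factorial) ^ (2 * d) := by
            gcongr; exact remainder_le _ _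
        _ = (C / 2) ^ (2 * r) / (l.factorial : ℝ) ^ (2 * d) * ‖y‖ ^ (2 * r) := by
            rw [div_pow, ← pow_mul, mul_pow, show l * (2 * d) = 2 * r by rw [hrdef]; ring]
            ring
        _ ≤ (C / 2) ^ (2 * r) / (l.factorial : ℝ) ^ (2 * d) *
              ((N : ℝ) ^ (r - 1) * ∑ j, y j ^ (2 * r)) := by
            gcongr; exact norm_pow_two_mul_le hr y
        _ = _ := by rw [hB]; ring
    have h2 := le_add_pow_div h0 ht0 (2 * d - 1)
    rw [show 2 * d - 1 + 1 = 2 * d by omega] at h2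
    have h3 : 1 ≤ 1 / t ^ (2 * d - 1) := by
      rw [le_div_iff₀ (by positivity), one_mul]
      exact pow_le_one₀ ht0.le ht1
    have h4 : 0 ≤ s ^ (2 * d) := by positivity
    calc s + s ^ (2 * d) ≤ t + s ^ (2 * d) / t ^ (2 * d - 1) + 1 * s ^ (2 * d) := by linarith
      _ ≤ t + s ^ (2 * d) / t ^ (2 * d - 1) + 1 / t ^ (2 * d - 1) * s ^ (2 * d) := by gcongr
      _ = t + 2 / t ^ (2 * d - 1) * s ^ (2 * d) := by ring
      _ ≤ t + 2 / t ^ (2 * d - 1) * (B * ∑ j, y j ^ (2 * r)) := by gcongr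
      _ = _ := by ring
  · have hkey : C ^ 2 / 4 * N * (A ^ 2 * (2 * r)) ≤ τ ^ 2 * (l / Real.exp 1) ^ 2 := by
      have h1 : (m : ℝ) ≤ 4 * d * l := by exact_mod_cast hml
      have h2 : A ^ 2 * (2 * d ^ 2 * Real.exp 1 ^ 2) * (N * C ^ 2) ≤ τ ^ 2 * (4 * d * l) := by
        calc _ ≤ K * τ ^ 2 * (N * C ^ 2) := by gcongr
          _ = τ ^ 2 * (K * (N * C ^ 2)) := by ring
          _ ≤ _ := mul_le_mul_of_nonneg_left (hm.trans h1) (by positivity)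
      have h3 : A ^ 2 * d * Real.exp 1 ^ 2 * (N * C ^ 2) ≤ τ ^ 2 * (2 * l) := by
        refine le_of_mul_le_mul_left ?_ (by positivity : (0 : ℝ) < 2 * d)
        linarith
      rw [div_pow, ← mul_div_assoc, le_div_iff₀ (by positivity), hrdef]
      push_cast
      have h4 := mul_le_mul_of_nonneg_left h3 (by positivity : (0 : ℝ) ≤ l / 2)
      linarith
    -- This is the single term l^l / l! of the series for exp(l).
    have hfac2 : (l / Real.exp 1) ^ l ≤ (l.factorial : ℝ) := by
      have h := Real.pow_div_factorial_le_exp (l : ℝ) hl'.le l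
      rw [div_le_iff₀ hfac] at h
      rw [div_pow, div_le_iff₀ (by positivity), ← Real.exp_nat_mul, mul_one, mul_comm]
      exact h
    have hmain : (C ^ 2 / 4 * N * (A ^ 2 * (2 * r))) ^ r / (l.factorial : ℝ) ^ (2 * d) ≤
        t ^ (2 * d) := by
      rw [div_le_iff₀ (by positivity)]
      calc _ ≤ (τ ^ 2 * (l / Real.exp 1) ^ 2) ^ r := by gcongr
        _ = t ^ (2 * d) * ((l / Real.exp 1) ^ l) ^ (2 * d) := by
            rw [ht, hrdef, mul_pow, ← pow_mul, ← pow_mul, ← pow_mul, ← pow_mul]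
            ring_nf
        _ ≤ _ := by gcongr
    have hA : (A * √((2 * r : ℕ) : ℝ)) ^ (2 * r) = (A ^ 2 * (2 * r)) ^ r := by
      rw [pow_mul, mul_pow, Real.sq_sqrt (by positivity)]
      push_cast; rfl
    have hNr : (N : ℝ) ^ (r - 1) * N = N ^ r := by rw [← pow_succ, Nat.sub_add_cancel hr]
    have hC2 : (C / 2) ^ (2 * r) = (C ^ 2 / 4) ^ r := by rw [pow_mul]; ring
    have htt : t ^ (2 * d) = t ^ (2 * d - 1) * t := by rw [← pow_succ, Nat.sub_add_cancel (by omega)]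
    calc t + 2 / t ^ (2 * d - 1) * B * (N * (A * √((2 * r : ℕ) : ℝ)) ^ (2 * r))
        = t + 2 / t ^ (2 * d - 1) *
            ((C ^ 2 / 4 * N * (A ^ 2 * (2 * r))) ^ r / (l.factorial : ℝ) ^ (2 * d)) := by
          rw [hA, hB, hC2, mul_pow _ (A ^ 2 * (2 * (r : ℝ))), mul_pow _ (N : ℝ), ← hNr]
          ring
      _ ≤ t + 2 / t ^ (2 * d - 1) * t ^ (2 * d) := by gcongr
      _ = 3 * t := by rw [htt]; field_simp; ring

/-- When `m` may be too small for moments of order `2 * d`, the cap s ≤ 2 gives s^(2d) ≤ 4^d s. The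
second moment then suffices, after splitting C‖y‖/2 at the threshold `τ`. -/
theorem small_block_bound {d : ℕ} (hd : 0 < d) {A τ K : ℝ} (hτ : 0 < τ)
    (hK : A ^ 2 * (2 * d ^ 2 * Real.exp 1 ^ 2) ≤ K * τ ^ 2) {N m : ℕ} {C : ℝ}
    (hC : 0 < C) (hmd : m ≤ 2 * d) (hm : K * (N * C ^ 2) ≤ m) :
    ∃ a b : ℝ, 0 ≤ b ∧
      (∀ y : EuclideanSpace ℝ (Fin N), remainder 1 (C / 2 * ‖y‖) +
        remainder 1 (C / 2 * ‖y‖) ^ (2 * d) ≤ a + b * ∑ j, y j ^ (2 * 1)) ∧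
      a + b * (N * (A * √((2 * 1 : ℕ) : ℝ)) ^ (2 * 1)) ≤ 4 ^ (d + 1) * τ := by
  have hd' : (1 : ℝ) ≤ d := by exact_mod_cast hd
  refine ⟨2 * 4 ^ d * τ, 2 * 4 ^ d * (1 / τ * (C / 2) ^ 2), by positivity, fun y => ?_, ?_⟩
  · have h0 := remainder_nonneg 1 (x := C / 2 * ‖y‖) (by positivity)
    have h1 : remainder 1 (C / 2 * ‖y‖) ≤ C / 2 * ‖y‖ := by simpa using remainder_le 1 (C / 2 * ‖y‖)
    have h2 : remainder 1 (C / 2 * ‖y‖) ≤ 2 := by simp [remainder]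
    set s := remainder 1 (C / 2 * ‖y‖)
    have h3 : s ^ (2 * d) ≤ 4 ^ d * s := by
      calc s ^ (2 * d) = s ^ (2 * d - 1) * s := by rw [← pow_succ, Nat.sub_add_cancel (by omega)]
        _ ≤ 2 ^ (2 * d - 1) * s := by gcongr
        _ ≤ 2 ^ (2 * d) * s := by gcongr <;> norm_num
        _ = _ := by rw [pow_mul]; norm_num
    have h4 := le_add_pow_div (s := C / 2 * ‖y‖) (by positivity) hτ 1
    have h5 : (1 : ℝ) ≤ 4 ^ d := one_le_pow₀ (by norm_num)
    have h6 : ‖y‖ ^ 2 = ∑ j, y j ^ (2 * 1) := EuclideanSpace.real_norm_sq_eq y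
    calc s + s ^ (2 * d) ≤ 1 * s + 4 ^ d * s := by linarith
      _ ≤ 4 ^ d * s + 4 ^ d * s := by gcongr
      _ = 2 * 4 ^ d * s := by ring
      _ ≤ 2 * 4 ^ d * (τ + (C / 2 * ‖y‖) ^ (1 + 1) / τ ^ 1) := by gcongr; linarith
      _ = 2 * 4 ^ d * τ + 2 * 4 ^ d * (1 / τ * (C / 2) ^ 2) * ‖y‖ ^ 2 := by ring
      _ = _ := by rw [h6]
  · have h1 : (m : ℝ) ≤ 2 * d := by exact_mod_cast hmd
    have he : (1 : ℝ) ≤ Real.exp 1 ^ 2 := one_le_pow₀ (Real.one_le_exp zero_le_one)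
    have h2 : A ^ 2 * (2 * d ^ 2) * (N * C ^ 2) ≤ 2 * d * τ ^ 2 := by
      calc A ^ 2 * (2 * d ^ 2) * (N * C ^ 2) = A ^ 2 * (2 * d ^ 2 * 1) * (N * C ^ 2) := by ring
        _ ≤ A ^ 2 * (2 * d ^ 2 * Real.exp 1 ^ 2) * (N * C ^ 2) := by gcongr
        _ ≤ K * τ ^ 2 * (N * C ^ 2) := by gcongr
        _ = τ ^ 2 * (K * (N * C ^ 2)) := by ring
        _ ≤ τ ^ 2 * (2 * d) := mul_le_mul_of_nonneg_left (hm.trans h1) (by positivity)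
        _ = _ := by ring
    have h3 : d * (A ^ 2 * (N * C ^ 2)) ≤ τ ^ 2 := by
      refine le_of_mul_le_mul_left ?_ (by positivity : (0 : ℝ) < 2 * d)
      linarith
    have h4 : A ^ 2 * (N * C ^ 2) ≤ τ ^ 2 :=
      (le_mul_of_one_le_left (by positivity) hd').trans h3
    have hA : (A * √((2 * 1 : ℕ) : ℝ)) ^ (2 * 1) = A ^ 2 * 2 := by
      rw [mul_one, mul_pow, Real.sq_sqrt (by positivity)]
      norm_num
    rw [hA]
    calc _ = 2 * 4 ^ d * (τ + 1 / τ * (A ^ 2 * (N * C ^ 2) / 2)) := by ring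
      _ ≤ 2 * 4 ^ d * (τ + 1 / τ * τ ^ 2) := by
          have : 0 ≤ A ^ 2 * (N * C ^ 2) := by positivity
          gcongr
          linarith
      _ = _ := by field_simp; ring

theorem exists_block_bound {d : ℕ} (hd : 0 < d) (A : ℝ) :
    ∃ K : ℝ, 0 < K ∧ ∀ (N m : ℕ) (C : ℝ), Even m → 0 < C → K * (N * C ^ 2) ≤ m →
      ∃ l r : ℕ, ∃ a b : ℝ, 0 ≤ b ∧ 2 * (l - 1) * d ≤ m ∧ 2 * r ≤ m ∧
        (∀ y : EuclideanSpace ℝ (Fin N), remainder l (C / 2 * ‖y‖) +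
          remainder l (C / 2 * ‖y‖) ^ (2 * d) ≤ a + b * ∑ j, y j ^ (2 * r)) ∧
        a + b * (N * (A * √((2 * r : ℕ) : ℝ)) ^ (2 * r)) ≤ Real.exp (-m) / (d * 4 ^ d) := by
  have hd' : (1 : ℝ) ≤ d := by exact_mod_cast hd
  have h4d : (1 : ℝ) ≤ 4 ^ d := one_le_pow₀ (by norm_num)
  set M : ℝ := d * 4 ^ d with hM
  have hM1 : 1 ≤ M := one_le_mul_of_one_le_of_one_le hd' h4d
  -- Since m ≤ 4dl, the factor exp(-4d) in `τ` makes `τ ^ l` absorb exp(-m). The denominator pays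
  -- for the constants 3 and 4^(d+1) of the block bounds and for the target d 4^d.
  set τ : ℝ := Real.exp (-(4 * d)) / (4 ^ (d + 1) * M) with hτdef
  have hτ : 0 < τ := by positivity
  have h4d1 : (4 : ℝ) ≤ 4 ^ (d + 1) := by rw [pow_succ]; linarith
  have hden : (4 : ℝ) ≤ 4 ^ (d + 1) * M := by nlinarith
  have hτ1 : τ ≤ 1 := by
    rw [hτdef, div_le_one (by positivity)]
    exact (Real.exp_le_one_iff.2 (by linarith)).trans (by linarith)
  -- The summand 1 keeps `K` positive even for `A = 0`, which forces `m > 0` as soon as `N > 0`.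
  set K : ℝ := (A ^ 2 * (2 * d ^ 2 * Real.exp 1 ^ 2) + 1) / τ ^ 2 with hKdef
  have hK : A ^ 2 * (2 * d ^ 2 * Real.exp 1 ^ 2) ≤ K * τ ^ 2 := by
    rw [hKdef, div_mul_cancel₀ _ (by positivity)]
    linarith
  have hK0 : 0 < K := by positivity
  refine ⟨K, hK0, fun N m C hme hC hm => ?_⟩
  rcases Nat.eq_zero_or_pos N with rfl | hN
  -- An empty block has only `y = 0`, where the remainder with `l = 1` vanishes. No moments are
  -- needed, and `m` may be zero.
  · refine ⟨1, 0, 0, 0, le_rfl, by simp, by simp, fun y => ?_, by simp; positivity⟩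
    have : ‖y‖ = 0 := by rw [Subsingleton.elim y 0, norm_zero]
    simp [this, remainder, hd.ne']
  have hm0 : 0 < m := by
    have hN' : (0 : ℝ) < N := by exact_mod_cast hN
    have : (0 : ℝ) < K * (N * C ^ 2) := by positivity
    exact_mod_cast this.trans_le hm
  -- Evenness makes the second moment available in the short case.
  have hm2 : 2 ≤ m := by
    obtain ⟨q, hq⟩ := hme
    omega
  rcases le_or_gt (2 * d) m with hmd | hmd
  -- This is the largest `l` for which the moment order `2 * (d * l)` stays within `m`. Rounding
  -- down loses at most a factor 2, so m ≤ 4dl.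
  · set l := m / (2 * d) with hldef
    have hl : 0 < l := Nat.div_pos hmd (by omega)
    have hlm : 2 * d * l ≤ m := Nat.mul_div_le m (2 * d)
    have hml : m ≤ 4 * d * l := by
      have h1 : m < 2 * d * (l + 1) := by
        rw [hldef]; exact Nat.lt_mul_div_succ m (by omega)
      have h2 : d ≤ d * l := Nat.le_mul_of_pos_right d hl
      nlinarith
    obtain ⟨a, b, hb, hy, hab⟩ := large_block_bound hd hτ hτ1 hK hN hC hl hml hm
    refine ⟨l, d * l, a, b, hb, ?_, by linarith, hy, hab.trans ?_⟩
    · calc 2 * (l - 1) * d ≤ 2 * l * d := by gcongr; omega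
        _ ≤ m := by linarith
    · rw [hτdef, div_pow, ← Real.exp_nat_mul, le_div_iff₀ (by positivity), mul_assoc,
        div_mul_eq_mul_div, ← mul_div_assoc, div_le_iff₀ (by positivity)]
      have h1 : 4 ^ (d + 1) * M ≤ (4 ^ (d + 1) * M) ^ l :=
        le_self_pow₀ (by linarith) hl.ne'
      have h2 : Real.exp (l * -(4 * d)) ≤ Real.exp (-m) := by
        rw [Real.exp_le_exp]
        have : (m : ℝ) ≤ 4 * d * l := by exact_mod_cast hml
        linarith
      calc 3 * (Real.exp (l * -(4 * d)) * M) = Real.exp (l * -(4 * d)) * (3 * M) := by ring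
        _ ≤ Real.exp (-m) * (4 ^ (d + 1) * M) := by gcongr; linarith
        _ ≤ _ := by gcongr
  · obtain ⟨a, b, hb, hy, hab⟩ := small_block_bound hd hτ hK hC hmd.le hm
    refine ⟨1, 1, a, b, hb, by simp, by omega, hy, hab.trans ?_⟩
    rw [hτdef, ← mul_div_assoc, mul_div_mul_left _ _ (by positivity)]
    gcongr
    have : (m : ℝ) ≤ 2 * d := by exact_mod_cast hmd.le
    linarith

end PTF

/-! ### Comparison of expectations -/

/-- The reference value is the expectation of `Q` under independent Gaussians, common to all
`k`-independent families. The dominating function is also a polynomial of degree at most `k`, so its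
expectation is controlled by the Gaussian moments. -/
theorem PTF.Decomposition.abs_integral_FTilde_sub_le {d n : ℕ} {A : ℝ} {m : Fin d → ℕ}
    {p : MvPolynomial (Fin n) ℝ} (D : PTF.Decomposition d n A m p) {C : Fin d → ℝ}
    {k : ℕ} (hk : ∀ i, d * m i ≤ k) {r : Fin d → ℕ} (hr : ∀ i, 2 * r i ≤ m i)
    {a b : Fin d → ℝ} (hb : ∀ i, 0 ≤ b i)
    {Q : MvPolynomial (Fin n) ℝ} (hQ : Q.totalDegree ≤ k)
    (hD : ∀ x, |D.FTilde C x - MvPolynomial.eval x Q| ≤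
      ∑ i, (a i + b i * ∑ j, MvPolynomial.eval x (D.usedP i j) ^ (2 * r i)))
    {Ω : Type*} [MeasurableSpace Ω] {μ : Measure Ω} [IsProbabilityMeasure μ] {X : Fin n → Ω → ℝ}
    (hX : PTF.IsKIndepGaussian μ k X) :
    |(∫ ω, D.FTilde C (fun j => X j ω) ∂μ) - ∫ y, MvPolynomial.eval y Q ∂(PTF.stdGaussian n)| ≤
      ∑ i, (a i + b i * (D.N i * (A * √((2 * r i : ℕ) : ℝ)) ^ (2 * r i))) := by
  have hd : ∀ i j, (D.usedP i j ^ (2 * r i)).totalDegree ≤ k := fun i j =>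
    calc (D.usedP i j ^ (2 * r i)).totalDegree ≤ 2 * r i * (D.usedP i j).totalDegree :=
          MvPolynomial.totalDegree_pow _ _
      _ ≤ m i * d := Nat.mul_le_mul (hr i) (D.totalDegree_usedP_le i j)
      _ ≤ k := (mul_comm _ _).trans_le (hk i)
  have hdm : ∀ i, 2 * r i ≤ d * m i := fun i =>
    (hr i).trans (Nat.le_mul_of_pos_left _ i.pos)
  have hpow : ∀ i j, Integrable
      (fun ω => MvPolynomial.eval (fun j => X j ω) (D.usedP i j) ^ (2 * r i)) μ ∧
      ∫ ω, MvPolynomial.eval (fun j => X j ω) (D.usedP i j) ^ (2 * r i) ∂μ ≤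
        (A * √((2 * r i : ℕ) : ℝ)) ^ (2 * r i) := fun i j => by
    have h1 := (hX.integral_eval_eq_sum (hd i j)).1
    have h2 := hX.integral_eval (hd i j)
    simp only [map_pow] at h1 h2
    exact ⟨h1, h2.trans_le (D.moment_usedP i j (hdm i))⟩
  have hi : ∀ i, Integrable (fun ω => b i * ∑ j,
      MvPolynomial.eval (fun j => X j ω) (D.usedP i j) ^ (2 * r i)) μ := fun i =>
    (integrable_finsetSum _ fun j _ => (hpow i j).1).const_mul _
  have hai : ∀ i, Integrable (fun ω => a i + b i * ∑ j,
      MvPolynomial.eval (fun j => X j ω) (D.usedP i j) ^ (2 * r i)) μ := fun i =>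
    (integrable_const _).add (hi i)
  have hW := integrable_finsetSum Finset.univ fun i _ => hai i
  have hQi := (hX.integral_eval_eq_sum hQ).1
  have hXm : AEMeasurable (fun ω j => X j ω) μ :=
    aemeasurable_pi_lambda _ fun j => (hX.1 j).aemeasurable
  have hFm : AEStronglyMeasurable (fun ω => D.FTilde C fun j => X j ω) μ :=
    ((D.measurable_FTilde C).comp_aemeasurable hXm).aestronglyMeasurable
  have hsub : Integrable (fun ω => D.FTilde C (fun j => X j ω) -
      MvPolynomial.eval (fun j => X j ω) Q) μ :=
    hW.mono' (hFm.sub hQi.aestronglyMeasurable) (.of_forall fun ω => hD _)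
  have hF : Integrable (fun ω => D.FTilde C fun j => X j ω) μ := by
    refine (hsub.add hQi).congr (.of_forall fun ω => ?_)
    simp
  rw [← hX.integral_eval hQ, ← integral_sub hF hQi]
  refine abs_integral_le_integral_abs.trans ((integral_mono hsub.abs hW fun ω => hD _).trans ?_)
  rw [integral_finsetSum _ fun i _ => hai i]
  refine Finset.sum_le_sum fun i _ => ?_
  rw [integral_add (integrable_const _) (hi i), integral_const_mul,
    integral_finsetSum _ fun j _ => (hpow i j).1]
  simp only [integral_const, probReal_univ, one_smul]
  have := hb i
  gcongr
  calc _ ≤ ∑ _j : Fin (D.N i), (A * √((2 * r i : ℕ) : ℝ)) ^ (2 * r i) :=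
        Finset.sum_le_sum fun j _ => (hpow i j).2
    _ = _ := by simp

theorem mainTheorem5 :
    ∃ c : ℝ, 0 < c ∧ ∀ d : ℕ, 0 < d → ∀ A : ℝ, ∃ K : ℝ, 0 < K ∧
      ∀ (n : ℕ) (p : MvPolynomial (Fin n) ℝ),
        PTF.IsMultilinear p → p.totalDegree ≤ d → PTF.sumSqCoeff p = 1 →
      ∀ m : Fin d → ℕ, (∀ i, Even (m i)) →
      ∀ D : PTF.Decomposition d n A m p,
      ∀ C : Fin d → ℝ, (∀ i, 0 < C i) →
      ∀ ε : ℝ, 0 < ε →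
        (∀ i, K * ((D.N i : ℝ) * C i ^ 2) ≤ (m i : ℝ)) →
        (∀ i, Real.log (2 ^ d / ε) ≤ (m i : ℝ)) →
      ∀ k : ℕ, (∀ i, d * m i ≤ k) →
      ∀ (Ω : Type*) [MeasurableSpace Ω] (μ : Measure Ω) [IsProbabilityMeasure μ]
        (Ω' : Type*) [MeasurableSpace Ω'] (ν : Measure Ω') [IsProbabilityMeasure ν]
        (X : Fin n → Ω → ℝ) (Y : Fin n → Ω' → ℝ),
        PTF.IsKIndepGaussian μ k X → PTF.IsKIndepGaussian ν k Y →
        |(∫ ω, D.FTilde C (fun j => Y j ω) ∂ν) - ∫ ω, D.FTilde C (fun j => X j ω) ∂μ| ≤ c * ε := by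
  refine ⟨2, two_pos, fun d hd A => ?_⟩
  obtain ⟨K, hK, hblock⟩ := PTF.exists_block_bound hd A
  refine ⟨K, hK, fun n p _ _ _ m hm D C hC ε hε hKm hlog k hk Ω _ μ _ Ω' _ ν _ X Y hX hY => ?_⟩
  choose l r a b hb hl hr hrem hab using fun i => hblock (D.N i) (m i) (C i) (hm i) (hC i) (hKm i)
  obtain ⟨Q, hQ, hQx⟩ := D.exists_polynomial_FTilde hC l
  have hQk : Q.totalDegree ≤ k := by
    refine hQ.trans ((Finset.sum_le_sum fun i _ => hl i).trans ?_)
    -- Each of the `d` blocks contributes degree at most `m i`, and `d * m i ≤ k`, so the sum fits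
    -- into `k`.
    refine Nat.le_of_mul_le_mul_left ?_ hd
    calc d * ∑ i, m i = ∑ i, d * m i := Finset.mul_sum _ _ _
      _ ≤ ∑ _i : Fin d, k := Finset.sum_le_sum fun i _ => hk i
      _ = d * k := by simp
  have hD : ∀ x, |D.FTilde C x - MvPolynomial.eval x Q| ≤
      ∑ i, (4 ^ d * a i + 4 ^ d * b i *
        ∑ j, MvPolynomial.eval x (D.usedP i j) ^ (2 * r i)) := fun x => by
    refine (hQx x).trans ((prod_one_add_sq_sub_one_le _ fun i => PTF.remainder_nonneg _ ?_).trans ?_)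
    · have := hC i
      positivity
    · rw [Finset.mul_sum]
      refine Finset.sum_le_sum fun i _ => ?_
      rw [mul_assoc, ← mul_add]
      exact mul_le_mul_of_nonneg_left (hrem i _) (by positivity)
  have hsum : ∑ i, (4 ^ d * a i + 4 ^ d * b i *
      (D.N i * (A * √((2 * r i : ℕ) : ℝ)) ^ (2 * r i))) ≤ ε := by
    have hexp : ∀ i, Real.exp (-m i) ≤ ε := fun i => by
      have h1 : 2 ^ d / ε ≤ Real.exp (m i) := (Real.log_le_iff_le_exp (by positivity)).1 (hlog i)
      have h2 : (1 : ℝ) ≤ 2 ^ d := one_le_pow₀ one_le_two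
      rw [div_le_iff₀ hε] at h1
      rw [Real.exp_neg, inv_le_iff_one_le_mul₀ (Real.exp_pos _), mul_comm]
      exact h2.trans h1
    have hd' : (0 : ℝ) < d := by exact_mod_cast hd
    calc _ ≤ ∑ _i : Fin d, ε / d := by
          refine Finset.sum_le_sum fun i _ => ?_
          rw [mul_assoc, ← mul_add]
          calc _ ≤ 4 ^ d * (Real.exp (-m i) / (d * 4 ^ d)) :=
                mul_le_mul_of_nonneg_left (hab i) (by positivity)
            _ = Real.exp (-m i) / d := by field_simp
            _ ≤ ε / d := by gcongr; exact hexp i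
      _ = ε := by simp; field_simp
  have hb' : ∀ i, 0 ≤ 4 ^ d * b i := fun i => mul_nonneg (by positivity) (hb i)
  have h1 := (D.abs_integral_FTilde_sub_le hk hr hb' hQk hD hX).trans hsum
  have h2 := (D.abs_integral_FTilde_sub_le hk hr hb' hQk hD hY).trans hsum
  rw [abs_le] at h1 h2 ⊢
  constructor <;> linarith [h1.1, h1.2, h2.1, h2.2]
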